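/- \textbf{Notation.} Let $p,m_0,m$ be integers with $p\ge1$ and $m\ge m_0\ge1$. Boldface letters denote $p$-vectors; inequalities, absolute values $|\boldsymbol\beta|$ and products $\mathbf j\mathbf v$ of vectors are coordinatewise; $\mathbf 1=(1,\dots,1)$, $\mathbf 0=(0,\dots,0)$, and $\wedge\mathbf x$, $\vee\mathbf x$ are the smallest and the largest coordinate of $\mathbf x$. For multi-indices, $\|\boldsymbol\alpha\|=\alpha_1+\dots+\alpha_p$, $\boldsymbol\alpha!=\prod_r\alpha_r!$, $\mathbf x^{\boldsymbol\alpha}=\prod_r x_r^{\alpha_r}$, and $g^{(\boldsymbol\alpha)}$ is the corresponding partial derivative; $\sum_{\mathbf k=\mathbf a}^{\mathbf b}$ is the sum over integer vectors $\mathbf k$ with $\mathbf a\le\mathbf k\le\mathbf b$. For $J\subseteq[p]=\{1,\dots,p\}$, $\mathbf 1_J$ is the indicator vector of $J$, so that $\mathbf n\mathbf 1_J$ has coordinates $n_r$ for $r\in J$ and $0$ otherwise. For integers $l,j\ge1$ let $$\gamma_{l,j}=(-1)^{j-1}\frac2j\binom{2l}{l+j}\Big/\binom{2l}{l},\qquad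 \tau_{l,j}=\sum_{b=0}^{\lfloor (l-j)/2\rfloor}\gamma_{l,j+2b},\qquad \gamma_{l,\mathbf j}=\prod_{r}\gamma_{l,j_r},\qquad \tau_{l,\mathbf j}=\prod_r\tau_{l,j_r}.$$ For $F\colon\mathbb R^p\to\mathbb R$, $\mathbf n\in\mathbb Z_+^p$ and $J\subseteq[p]$ let $$A^J_{l,F}(\mathbf n)=\sum_{\mathbf j=\mathbf 1}^{l\mathbf 1}\gamma_{l,\mathbf j}\sum_{\mathbf i=\mathbf 0}^{\mathbf j-\mathbf 1}F(\mathbf n\mathbf 1_J-\mathbf 1+\mathbf j/2-\mathbf i),\qquad \tilde A_{l,F}(\mathbf n)=\sum_{\emptyset\ne J\subseteq[p]}(-1)^{p-|J|}A^J_{l,F}(\mathbf n).$$ \textbf{Theorem.} Let $f\colon\mathbb R^p\to\mathbb R$ be $2m$ times continuously differentiable, and let $F\colon\mathbb R^p\to\mathbb R$ be a $2m_0$ times continuously differentiable antiderivative of $f$; that is, the mixed partial derivative $F^{(\mathbf 1)}$ of $F$, once in each coordinate (taken in some order), exists everywhere and equals $f$. Suppose that $$F^{(\boldsymbol\alpha)}(\mathbf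 x)\to0\quad\text{as }\vee\mathbf x\to\infty,\ \text{ for each }\boldsymbol\alpha\in\mathbb Z_+^p\text{ with }\|\boldsymbol\alpha\|=2m_0,$$ and that, for each $\boldsymbol\alpha\in\mathbb Z_+^p$ with $\|\boldsymbol\alpha\|=2m$, the sums $\sum_{\mathbf k=\mathbf 0}^{\mathbf n-\mathbf 1}f^{(\boldsymbol\alpha)}(\mathbf k+\mathbf u)$ converge as $\wedge\mathbf n\to\infty$, uniformly in $\mathbf u\in[-m/2,m/2]^p$; denote the limit by $\sum_{\mathbf k=\mathbf 0}^{\infty\mathbf 1}f^{(\boldsymbol\alpha)}(\mathbf k+\mathbf u)$. Then: (i) The following limit exists and has the stated value: $$\sum_{\mathbf k\ge\mathbf 0}^{\mathrm{Alt}}f(\mathbf k):=\lim_{\wedge\mathbf n\to\infty}\Big(\sum_{\mathbf k=\mathbf 0}^{\mathbf n-\mathbf 1}f(\mathbf k)-\tilde A_{m_0,F}(\mathbf n)\Big)=(-1)^pA^\emptyset_{m,F}(\mathbf 0)-R_{m,f}(\infty),$$ where $$R_{m,f}(\infty)=\frac m{2^{2m+p-1}}\sum_{\|\boldsymbol\alpha\|=2m}\frac1{\boldsymbol\alpha!}\int_0^1ds\,(1-s)^{2m-1}\int_{[-1,1]^p}d\mathbf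 v\,\mathbf v^{\boldsymbol\alpha}\sum_{\mathbf j=\mathbf 1}^{m\mathbf 1}\gamma_{m,\mathbf j}\,\mathbf j^{\boldsymbol\alpha+\mathbf 1}\sum_{\mathbf k=\mathbf 0}^{\infty\mathbf 1}f^{(\boldsymbol\alpha)}(\mathbf k+s\mathbf j\mathbf v/2).$$ (ii) For all integers $l\ge1$, all $J\subseteq[p]$ and all $\mathbf n\in\mathbb Z_+^p$, $$A^J_{l,F}(\mathbf n)=\sum_{\boldsymbol\beta=(1-l)\mathbf 1}^{(l-1)\mathbf 1}\tau_{l,\mathbf 1+|\boldsymbol\beta|}\,F(\mathbf n\mathbf 1_J-\mathbf 1/2-\boldsymbol\beta/2)=\sum_{\boldsymbol\alpha=\mathbf 0}^{(l-1)\mathbf 1}\tau_{l,\mathbf 1+\boldsymbol\alpha}\sum_{\boldsymbol\beta\in\mathbb Z^p\colon|\boldsymbol\beta|=\boldsymbol\alpha}F(\mathbf n\mathbf 1_J-\mathbf 1/2-\boldsymbol\beta/2).$$ (iii) If $M$ is a real number such that $\big|\sum_{\mathbf k=\mathbf 0}^{\mathbf n-\mathbf 1}f^{(\boldsymbol\alpha)}(\mathbf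 k+\mathbf u)\big|\le M$ for all $\mathbf n\in\mathbb Z_+^p$, all $\boldsymbol\alpha$ with $\|\boldsymbol\alpha\|=2m$ and all $\mathbf u\in(-m/2,m/2]^p$, then $$|R_{m,f}(\infty)|\le\frac M{2^{2m}}\sum_{\|\boldsymbol\alpha\|=2m}\frac1{(\boldsymbol\alpha+\mathbf 1)!}\sum_{\mathbf j=\mathbf 1}^{m\mathbf 1}|\gamma_{m,\mathbf j}|\,\mathbf j^{\boldsymbol\alpha+\mathbf 1}\le M\,\frac{1.0331\,(\pi m)^{(p+1)/2}}{(2m+1)!}\,(\kappa pm)^{2m},$$ where $\kappa=\sqrt{\Lambda_*/4}$ and $\Lambda_*=\max_{0<t<1}(1-t)^{t-1}(1+t)^{-1-t}t^2$; if $m\ge2$, the factor $1.0331$ can be replaced by $1.001$. (iv) For all integers $l\ge1$, all $J\subseteq[p]$ and all $\mathbf n\in\mathbb Z_+^p$, $$A^\emptyset_{l,F}(\mathbf 0)=A^\emptyset_{l,F}(\mathbf n)=A^J_{l,F}(\mathbf 0)=\sum_{\boldsymbol\alpha=\mathbf 0}^{(l-1)\mathbf 1}\tau_{l,\mathbf 1+\boldsymbol\alpha}\sum_{\boldsymbol\beta\in\mathbb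 Z^p\colon|\boldsymbol\beta|=\boldsymbol\alpha}F(\boldsymbol\beta/2-\mathbf 1/2).$$ -/

import Mathlib

noncomputable section

namespace AltSum

/-- The filter on `ℕ^p` describing `min n → ∞`. -/
def minToInfty (p : ℕ) : Filter (Fin p → ℕ) :=
  Filter.comap (fun n : Fin p → ℕ => ⨅ r, n r) Filter.atTop

/-- The filter on `ℝ^p` describing `max x → ∞` (the largest coordinate tends to `+∞`). -/
def maxToInfty (p : ℕ) : Filter (Fin p → ℝ) :=
  Filter.comap (fun x : Fin p → ℝ => ⨆ r, x r) Filter.atTop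

/-- The partial derivative in the `r`-th coordinate. -/
def partialDeriv {p : ℕ} (r : Fin p) (g : (Fin p → ℝ) → ℝ) : (Fin p → ℝ) → ℝ :=
  fun x => lineDeriv ℝ g x (Pi.single r 1)

/-- The partial derivative `g^(α) = ∂₁^α₁ ⋯ ∂ₚ^αₚ g` for a multi-index `α`. -/
def multiDeriv {p : ℕ} (α : Fin p → ℕ) (g : (Fin p → ℝ) → ℝ) : (Fin p → ℝ) → ℝ :=
  (List.finRange p).foldr (fun r h => (partialDeriv r)^[α r] h) g

/-- `F` is an antiderivative of `f`: the mixed partial derivative of `F`, once in each of the `p`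
coordinates (in some order `σ`), exists everywhere and equals `f`.  The functions
`G 0 = F, G 1, …, G p = f` are the successive partial derivatives. -/
def IsAntiderivative {p : ℕ} (F f : (Fin p → ℝ) → ℝ) : Prop :=
  ∃ (σ : Equiv.Perm (Fin p)) (G : Fin (p + 1) → (Fin p → ℝ) → ℝ),
    G 0 = F ∧ G (Fin.last p) = f ∧
      ∀ (r : Fin p) (x : Fin p → ℝ),
        HasLineDerivAt ℝ (G r.castSucc) (G r.succ x) x (Pi.single (σ r) 1)

/-- The multi-indices `k` with `0 ≤ k ≤ n - 1`; empty if some `n r = 0`. -/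
def box {p : ℕ} (n : Fin p → ℕ) : Finset (Fin p → ℕ) :=
  Fintype.piFinset fun r => Finset.range (n r)

/-- The partial sum of `g (k + u)` over `0 ≤ k ≤ n - 1`. -/
def shiftedSum {p : ℕ} (g : (Fin p → ℝ) → ℝ) (n : Fin p → ℕ) (u : Fin p → ℝ) : ℝ :=
  ∑ k ∈ box n, g (fun r => (k r : ℝ) + u r)

/-- The sum of the multi-index series of the `g (k + u)` over all `k ≥ 0`, as the limit of the
partial sums over `0 ≤ k ≤ n - 1` when `min n → ∞`. -/
def shiftedSeries {p : ℕ} (g : (Fin p → ℝ) → ℝ) (u : Fin p → ℝ) : ℝ :=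
  Filter.limUnder (minToInfty p) fun n => shiftedSum g n u

/-- The coefficient `γ_{m,j}` for an integer `j ≥ 1`. -/
def gamma1 (m j : ℕ) : ℝ :=
  (-1) ^ (j - 1) * (2 / (j : ℝ)) * (((2 * m).choose (m + j) : ℝ) / ((2 * m).choose m : ℝ))

/-- The coefficient `γ_{m,j}` for a multi-index `j`. -/
def gammaCoeff {p : ℕ} (m : ℕ) (j : Fin p → ℕ) : ℝ := ∏ r, gamma1 m (j r)

/-- The coefficient `τ_{m,j}` for an integer `1 ≤ j ≤ m`. -/
def tau1 (m j : ℕ) : ℝ := ∑ b ∈ Finset.range ((m - j) / 2 + 1), gamma1 m (j + 2 * b)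

/-- The coefficient `τ_{m,j}` for a multi-index `j`. -/
def tauCoeff {p : ℕ} (m : ℕ) (j : Fin p → ℕ) : ℝ := ∏ r, tau1 m (j r)

/-- `n 1_J`, as a point of `ℝ^p`. -/
def restrictTo {p : ℕ} (J : Finset (Fin p)) (n : Fin p → ℕ) : Fin p → ℝ :=
  fun r => if r ∈ J then (n r : ℝ) else 0

/-- `A^J_{m,F}(n)`. -/
def AJ {p : ℕ} (m : ℕ) (F : (Fin p → ℝ) → ℝ) (J : Finset (Fin p)) (n : Fin p → ℕ) : ℝ :=
  ∑ j ∈ Finset.Icc (1 : Fin p → ℕ) (fun _ => m), gammaCoeff m j *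
    ∑ i ∈ box j, F (fun r => restrictTo J n r - 1 + (j r : ℝ) / 2 - (i r : ℝ))

/-- `Ã_{m,F}(n)`. -/
def tildeA {p : ℕ} (m : ℕ) (F : (Fin p → ℝ) → ℝ) (n : Fin p → ℕ) : ℝ :=
  ∑ J ∈ (Finset.univ : Finset (Finset (Fin p))).erase ∅, (-1) ^ (p - J.card) * AJ m F J n

/-- The generalized sum of the series of the `f k`, `k ≥ 0`. -/
def altSum {p : ℕ} (m₀ : ℕ) (F f : (Fin p → ℝ) → ℝ) : ℝ :=
  Filter.limUnder (minToInfty p) fun n => (∑ k ∈ box n, f (fun r => (k r : ℝ))) - tildeA m₀ F n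

/-- The finite set of all `β ∈ ℤ^p` with `|β| = α` coordinatewise. -/
def absFiber {p : ℕ} (α : Fin p → ℕ) : Finset (Fin p → ℤ) :=
  (Finset.Icc (fun r => -(α r : ℤ)) (fun r => (α r : ℤ))).filter fun β => ∀ r, (β r).natAbs = α r

/-- The multi-indices `α` with `α₁ + ⋯ + αₚ = d`. -/
def multiIndices (p d : ℕ) : Finset (Fin p → ℕ) := Finset.piAntidiag Finset.univ d

/-- The remainder `R_{m,f}(∞)`. -/
def remainderInfty {p : ℕ} (m : ℕ) (f : (Fin p → ℝ) → ℝ) : ℝ :=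
  (m : ℝ) / 2 ^ (2 * m + p - 1) *
    ∑ α ∈ multiIndices p (2 * m), 1 / (∏ r, ((α r).factorial : ℝ)) *
      ∫ s in (0 : ℝ)..1, (1 - s) ^ (2 * m - 1) *
        ∫ v in Set.Icc (-1 : Fin p → ℝ) 1, (∏ r, v r ^ α r) *
          ∑ j ∈ Finset.Icc (1 : Fin p → ℕ) (fun _ => m),
            gammaCoeff m j * (∏ r, (j r : ℝ) ^ (α r + 1)) *
              shiftedSeries (multiDeriv α f) (fun r => s * (j r : ℝ) * v r / 2)

/-- `Λ(t) = (1 - t)^(t - 1) (1 + t)^(-1 - t) t²`, for `0 < t < 1`. -/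
def Lam (t : ℝ) : ℝ := (1 - t) ^ (t - 1) * (1 + t) ^ (-1 - t) * t ^ 2

/-- `Λ_*`, the maximum of `Λ` over the interval `(0,1)`. -/
def LamStar : ℝ := sSup (Lam '' Set.Ioo 0 1)

/-- `κ = √(Λ_* / 4)`. -/
def kappa : ℝ := Real.sqrt (LamStar / 4)

/-- The sharper of the two upper bounds on the remainder. -/
def remainderBound (p m : ℕ) (M : ℝ) : ℝ :=
  M / 2 ^ (2 * m) *
    ∑ α ∈ multiIndices p (2 * m), 1 / (∏ r, ((α r + 1).factorial : ℝ)) *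
      ∑ j ∈ Finset.Icc (1 : Fin p → ℕ) (fun _ => m),
        |gammaCoeff m j| * ∏ r, (j r : ℝ) ^ (α r + 1)

/-- The simpler of the two upper bounds on the remainder, with numerical factor `c`. -/
def simpleBound (c : ℝ) (p m : ℕ) (M : ℝ) : ℝ :=
  M * (c * (Real.pi * m) ^ (((p : ℝ) + 1) / 2) / ((2 * m + 1).factorial : ℝ)) *
    (kappa * p * m) ^ (2 * m)

end AltSum

end

/-! ### Ratios of factorials through Stirling's sequence, and the function `Lam`. -/

namespace AltSum

open Real Finset

/-! If `G` is an antiderivative of `g`, the alternating sum of `G` over the corners of the box `∏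
[-j_r/2, j_r/2]` is the integral of `g` over that box. The weights `γ_{m,j}` are chosen so that,
after summing over `j`, these integrals reproduce `g(0)` whenever `g` is a polynomial of total
degree below `2m` (`sum_gamma1_mul_pow`, `sum_gammaCoeff_taylor`). For a general `g`, Taylor
expansion at `0` leaves the integral remainder (`apply_zero_eq`).

This is applied to `g(u) = ∑_{k<n} f(k+u)`, whose antiderivative is the same sum for `F`, so that
`g(0)` is the partial sum under study. In each coordinate the corner differences of the sum for `F`
telescope to boundary values (`sum_range_sub_half`, `sum_sign_sum_box_eq`). The outcome,
`sum_box_eq`, is exact for every `n`: the partial sum equals `Ã_m(n) + (-1)^p A^∅_m(0)` minus a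
remainder containing partial sums of the derivatives of order `2m`.

As `min n → ∞`, uniform convergence and dominated convergence move the remainder to `R_{m,f}(∞)`
(`tendsto_remainderOf`). To replace `Ã_m` by `Ã_{m₀}`, note that the functionals `A_m` and `A_{m₀}`
have the same moments of total degree below `2m₀`, since both invert a unit difference on
polynomials (`sum_gamma1_moment_eq`). Their difference is therefore made of Taylor remainders in
derivatives of `F` of order `2m₀`, taken where some coordinate tends to infinity
(`tendsto_tildeA_sub_tildeA`).

The expression by `τ` is a regrouping of equal arguments of `F`, done in one coordinate and carried
to `p` coordinates by `sum_pi_congr`.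

The first bound on the remainder is the triangle inequality. For the second, `1/(α+1)!` is compared
with a multinomial coefficient and the power mean inequality separates the coordinates
(`remainderBound_le_simpleBound`). Two sums over one index remain: `∑ |γ_j| j`, controlled by
Wallis' product, and `∑ |γ_j| j^(2m+1)`. In the latter, log-convexity of Stirling's sequence bounds
each term with `j < m` by `m^(2m) Λ_*^m` times a multiple of the derivative of `arcsin` at `j/m`,
and the sum is compared with `∫ arcsin' = π/2`. -/

/-- The decrement of the logarithm has a series expansion whose terms each decrease in the index. -/
theorem log_stirlingSeq_sub_antitone {k n : ℕ} (h : k ≤ n) :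
    log (Stirling.stirlingSeq (n + 1)) - log (Stirling.stirlingSeq (n + 2)) ≤
      log (Stirling.stirlingSeq (k + 1)) - log (Stirling.stirlingSeq (k + 2)) := by
  refine hasSum_le (fun i => ?_) (Stirling.log_stirlingSeq_sdiff_hasSum n)
    (Stirling.log_stirlingSeq_sdiff_hasSum k)
  gcongr

/-- Log-convexity of Stirling's sequence. -/
theorem stirlingSeq_sq_le (a j : ℕ) :
    Stirling.stirlingSeq (a + 1 + j) ^ 2 ≤
      Stirling.stirlingSeq (a + 1) * Stirling.stirlingSeq (a + 1 + 2 * j) := by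
  induction j generalizing a with
  | zero => simp [sq]
  | succ j ih =>
    have h1 := ih (a + 1)
    -- The induction moves both outer indices by one step; this compares the decrements at the two
    -- ends.
    have h2 := log_stirlingSeq_sub_antitone (k := a) (n := a + 1 + 2 * j) (by omega)
    have e1 : a + 1 + 1 + j = a + 1 + (j + 1) := by ring
    have e2 : a + 1 + 1 + 2 * j = a + 1 + 2 * j + 1 := by ring
    have e3 : a + 1 + 2 * (j + 1) = a + 1 + 2 * j + 2 := by ring
    rw [e1, e2] at h1
    rw [e3]
    refine h1.trans ?_
    have p1 := Stirling.stirlingSeq'_pos a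
    have p2 := Stirling.stirlingSeq'_pos (a + 1)
    have p3 := Stirling.stirlingSeq'_pos (a + 1 + 2 * j)
    have p4 := Stirling.stirlingSeq'_pos (a + 1 + 2 * j + 1)
    rw [← Real.log_le_log_iff (by positivity) (by positivity), Real.log_mul p2.ne' p3.ne',
      Real.log_mul p1.ne' p4.ne']
    linarith

theorem factorial_eq_stirlingSeq {n : ℕ} (hn : n ≠ 0) :
    (n.factorial : ℝ) = Stirling.stirlingSeq n * (√(2 * n : ℝ) * (n / exp 1) ^ n) := by
  have : (0 : ℝ) < n := by positivity
  rw [Stirling.stirlingSeq]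
  field_simp

/-- Writing each factorial as its Stirling approximation times `stirlingSeq`, the powers of `e`
cancel and the `stirlingSeq` factors have quotient at most `1` by log-convexity. The smallest index
is written `a + 1` because `stirlingSeq` is positive only from `1` on. -/
theorem factorial_sq_div_le (a j : ℕ) :
    ((a + 1 + j).factorial : ℝ) ^ 2 / ((a + 1).factorial * (a + 1 + 2 * j).factorial) ≤
      ((a + 1 + j : ℕ) : ℝ) / √(((a + 1 : ℕ) : ℝ) * (a + 1 + 2 * j : ℕ)) *
        (((a + 1 + j : ℕ) : ℝ) ^ (2 * (a + 1 + j)) /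
          (((a + 1 : ℕ) : ℝ) ^ (a + 1) * ((a + 1 + 2 * j : ℕ) : ℝ) ^ (a + 1 + 2 * j))) := by
  have key := stirlingSeq_sq_le a j
  rw [factorial_eq_stirlingSeq (n := a + 1 + j) (by omega),
    factorial_eq_stirlingSeq (n := a + 1) (by omega),
    factorial_eq_stirlingSeq (n := a + 1 + 2 * j) (by omega)]
  have p1 : 0 < Stirling.stirlingSeq (a + 1) := Stirling.stirlingSeq'_pos a
  have p2 : 0 < Stirling.stirlingSeq (a + 1 + 2 * j) := by
    have := Stirling.stirlingSeq'_pos (a + 2 * j)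
    rwa [show a + 2 * j + 1 = a + 1 + 2 * j by ring] at this
  have hx : (0 : ℝ) < (a + 1 : ℕ) := by positivity
  have hz : (0 : ℝ) < (a + 1 + 2 * j : ℕ) := by positivity
  have hy : (0 : ℝ) < (a + 1 + j : ℕ) := by positivity
  have hN : 2 * (a + 1 + j) = (a + 1) + (a + 1 + 2 * j) := by ring
  generalize Stirling.stirlingSeq (a + 1) = s at *
  generalize Stirling.stirlingSeq (a + 1 + 2 * j) = t at *
  generalize Stirling.stirlingSeq (a + 1 + j) = u at *
  generalize hX : ((a + 1 : ℕ) : ℝ) = X at *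
  generalize hZ : ((a + 1 + 2 * j : ℕ) : ℝ) = Z at *
  generalize hY : ((a + 1 + j : ℕ) : ℝ) = Y at *
  have e1 : (u * (√(2 * Y) * (Y / exp 1) ^ (a + 1 + j))) ^ 2 =
      u ^ 2 * (2 * Y * (Y ^ (2 * (a + 1 + j)) / exp 1 ^ (2 * (a + 1 + j)))) := by
    rw [mul_pow, mul_pow, Real.sq_sqrt (by positivity), ← pow_mul, mul_comm (a + 1 + j) 2, div_pow]
  have e2 : s * (√(2 * X) * (X / exp 1) ^ (a + 1)) *
      (t * (√(2 * Z) * (Z / exp 1) ^ (a + 1 + 2 * j))) =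
      (s * t) * (2 * √(X * Z) * (X ^ (a + 1) * Z ^ (a + 1 + 2 * j) /
        exp 1 ^ (2 * (a + 1 + j)))) := by
    have : √(2 * X) * √(2 * Z) = 2 * √(X * Z) := by
      rw [← Real.sqrt_mul (by positivity), show 2 * X * (2 * Z) = 2 ^ 2 * (X * Z) by ring,
        Real.sqrt_mul (by positivity), Real.sqrt_sq (by norm_num)]
    rw [div_pow, div_pow, ← this, hN, pow_add (exp 1)]
    field_simp
    ring
  have hE : 0 < exp 1 ^ (2 * (a + 1 + j)) := by positivity
  have hS : 0 < √(X * Z) := by positivity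
  rw [e1, e2]
  have e3 : Y / √(X * Z) * (Y ^ (2 * (a + 1 + j)) / (X ^ (a + 1) * Z ^ (a + 1 + 2 * j))) =
      (2 * Y * (Y ^ (2 * (a + 1 + j)) / exp 1 ^ (2 * (a + 1 + j)))) /
      (2 * √(X * Z) * (X ^ (a + 1) * Z ^ (a + 1 + 2 * j) / exp 1 ^ (2 * (a + 1 + j)))) := by
    field_simp
  rw [e3, mul_div_mul_comm]
  refine mul_le_of_le_one_left (by positivity) ?_
  rw [div_le_one (by positivity)]
  exact key

/-- At `t = j/(a+j)` the real exponents in `Lam`, multiplied by `a + j`, become the integers `-a`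
and `-(a+2j)`. -/
theorem Lam_pow_eq {a j : ℕ} (ha : 0 < a) (hj : 0 < j) :
    Lam ((j : ℝ) / (a + j : ℕ)) ^ (a + j) =
      (j : ℝ) ^ (2 * (a + j)) / ((a : ℝ) ^ a * ((a + 2 * j : ℕ) : ℝ) ^ (a + 2 * j)) := by
  have hA : (0 : ℝ) < a := by positivity
  have hJ : (0 : ℝ) < j := by positivity
  have hM : (0 : ℝ) < (a + j : ℕ) := by positivity
  have hM' : ((a + j : ℕ) : ℝ) = a + j := by push_cast; ring
  have hZ' : ((a + 2 * j : ℕ) : ℝ) = a + 2 * j := by push_cast; ring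
  have e1 : 1 - (j : ℝ) / (a + j : ℕ) = a / (a + j : ℕ) := by rw [hM'] at *; field_simp; ring
  have e2 : 1 + (j : ℝ) / (a + j : ℕ) = (a + 2 * j : ℕ) / (a + j : ℕ) := by
    rw [hM', hZ'] at *; field_simp; ring
  have e3 : ((j : ℝ) / (a + j : ℕ) - 1) * (a + j : ℕ) = -(a : ℝ) := by
    rw [hM'] at *; field_simp; ring
  have e4 : (-1 - (j : ℝ) / (a + j : ℕ)) * (a + j : ℕ) = -((a + 2 * j : ℕ) : ℝ) := by
    rw [hM', hZ'] at *; field_simp; ring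
  have hZ : (0 : ℝ) < (a + 2 * j : ℕ) := by positivity
  rw [Lam, mul_pow, mul_pow, e1, e2, ← Real.rpow_natCast, ← Real.rpow_natCast,
    ← Real.rpow_mul (by positivity), ← Real.rpow_mul (by positivity), e3, e4,
    Real.rpow_neg (by positivity), Real.rpow_neg (by positivity), Real.rpow_natCast,
    Real.rpow_natCast, ← pow_mul, div_pow, div_pow, div_pow,
    show 2 * (a + j) = a + (a + 2 * j) by ring, pow_add (((a + j : ℕ) : ℝ))]
  generalize ((a + 2 * j : ℕ) : ℝ) = Z at *
  generalize ((a + j : ℕ) : ℝ) = M at *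
  field_simp
  ring

theorem Lam_nonneg {t : ℝ} (h : t ∈ Set.Ioo (0 : ℝ) 1) : 0 ≤ Lam t := by
  have := h.1; have := h.2
  have h1 : 0 < 1 - t := by linarith
  have h2 : 0 < 1 + t := by linarith
  unfold Lam; positivity

/-- Needed for `LamStar`, a `sSup`, to dominate the values of `Lam`. The only factor above `1` is
`(1-t)^(t-1)`, and `1 - 1/x ≤ log x` at `x = 1-t` bounds it by `e^t`. -/
theorem bddAbove_Lam : BddAbove (Lam '' Set.Ioo 0 1) := by
  refine ⟨exp 1, ?_⟩
  rintro _ ⟨t, ⟨h0, h1⟩, rfl⟩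
  have h3 : 0 < 1 - t := by linarith
  have e1 : (1 - t) ^ (t - 1) ≤ exp 1 := by
    rw [Real.rpow_def_of_pos h3, exp_le_exp]
    have := Real.one_sub_inv_le_log_of_pos h3
    have h4 : (1 - t) * (1 - (1 - t)⁻¹) ≤ (1 - t) * log (1 - t) := by gcongr
    rw [mul_sub, mul_inv_cancel₀ h3.ne'] at h4
    linarith
  have e2 : (1 + t) ^ (-1 - t) ≤ 1 :=
    Real.rpow_le_one_of_one_le_of_nonpos (by linarith) (by linarith)
  have e3 : t ^ 2 ≤ 1 := by nlinarith
  have e4 : 0 ≤ (1 + t) ^ (-1 - t) := by positivity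
  have e5 : 0 ≤ (1 - t) ^ (t - 1) := by positivity
  unfold Lam
  calc _ ≤ exp 1 * 1 * 1 := by gcongr
    _ = exp 1 := by ring

theorem Lam_le_LamStar {t : ℝ} (h : t ∈ Set.Ioo (0 : ℝ) 1) : Lam t ≤ LamStar :=
  le_csSup bddAbove_Lam ⟨t, h, rfl⟩

theorem LamStar_lower : (0.30812 : ℝ) ≤ LamStar := by
  -- The maximizer solves `artanh t = 1/t`, so `t ≈ 0.8336`; the nearby `5/6` has a rational sixth
  -- power `Lam(5/6)^6 = 5^12/11^11`.
  refine le_trans ?_ (Lam_le_LamStar (t := 5 / 6) (by norm_num))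
  have h := Lam_pow_eq (a := 1) (j := 5) (by norm_num) (by norm_num)
  norm_num at h
  have h0 : 0 ≤ Lam (5 / 6) := Lam_nonneg (by norm_num)
  refine le_of_pow_le_pow_left₀ (n := 6) (by norm_num) h0 ?_
  rw [h]; norm_num

end AltSum

/-! ### The two one-dimensional sums `∑ |γ_j| j` and `∑ |γ_j| j^(2m+1)`. -/

namespace AltSum

open Real Finset

theorem sum_Icc_one_eq_sum_range (g : ℕ → ℝ) (m : ℕ) :
    ∑ j ∈ Icc 1 m, g j = ∑ j ∈ range m, g (j + 1) := by
  rw [range_eq_Ico, sum_Ico_add' g 0 m 1, zero_add]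
  rfl

theorem sum_range_two_mul_add_one (h : ℕ → ℝ) (m : ℕ) :
    ∑ i ∈ range (2 * m + 1), h i = h m + ∑ j ∈ Icc 1 m, (h (m + j) + h (m - j)) := by
  rw [sum_Icc_one_eq_sum_range, show 2 * m + 1 = m + (m + 1) by ring, sum_range_add,
    sum_range_succ', sum_add_distrib, ← sum_range_reflect h m, add_zero]
  have : ∑ j ∈ range m, h (m - 1 - j) = ∑ j ∈ range m, h (m - (j + 1)) :=
    sum_congr rfl fun j _ => by rw [Nat.sub_sub, add_comm 1 j]
  rw [this]; ring

theorem choose_sub_eq {m j : ℕ} (hj : j ≤ m) :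
    (2 * m).choose (m - j) = (2 * m).choose (m + j) := by
  rw [← Nat.choose_symm_of_eq_add]; omega

theorem sum_choose_div (m : ℕ) :
    ∑ j ∈ Icc 1 m, 2 * (((2 * m).choose (m + j) : ℝ) / ((2 * m).choose m : ℝ)) =
      4 ^ m / ((2 * m).choose m : ℝ) - 1 := by
  have h := sum_range_two_mul_add_one (fun i => ((2 * m).choose i : ℝ)) m
  have h2 : ∑ i ∈ range (2 * m + 1), ((2 * m).choose i : ℝ) = 4 ^ m := by
    have := Nat.sum_range_choose (2 * m)
    rw [pow_mul] at this
    exact_mod_cast this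
  have h3 : ∑ j ∈ Icc 1 m, (((2 * m).choose (m + j) : ℝ) + ((2 * m).choose (m - j) : ℝ)) =
      ∑ j ∈ Icc 1 m, 2 * ((2 * m).choose (m + j) : ℝ) :=
    sum_congr rfl fun j hj => by rw [choose_sub_eq (mem_Icc.1 hj).2]; ring
  have hc : (0 : ℝ) < (2 * m).choose m := by exact_mod_cast Nat.choose_pos (by omega)
  simp only [← mul_div_assoc]
  rw [← sum_div, ← h3, ← h2, h]
  field_simp
  ring

/-- Wallis' inequality `W_m ≤ π/2` bounds the square of `4^m / C(2m,m)` by `πm + π/2`, which is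
below `(√(πm) + 1)^2`. -/
theorem four_pow_div_choose_le {m : ℕ} (hm : 1 ≤ m) :
    4 ^ m / ((2 * m).choose m : ℝ) - 1 ≤ √(π * m) := by
  have h := Real.Wallis.W_le m
  rw [Real.Wallis.W_eq_factorial_ratio] at h
  have hch : ((2 * m).choose m : ℝ) = (2 * m).factorial / (m.factorial * m.factorial) := by
    rw [Nat.cast_choose ℝ (by omega : m ≤ 2 * m)]
    congr 3; congr 1; omega
  have hm' : (1 : ℝ) ≤ m := by exact_mod_cast hm
  have hc : (0 : ℝ) < (2 * m).choose m := by exact_mod_cast Nat.choose_pos (by omega)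
  have key : (4 ^ m / ((2 * m).choose m : ℝ)) ^ 2 ≤ π * m + π / 2 := by
    have e : (4 ^ m / ((2 * m).choose m : ℝ)) ^ 2 =
        2 ^ (4 * m) * (m.factorial : ℝ) ^ 4 / ((2 * m).factorial ^ 2 * (2 * m + 1)) *
          (2 * m + 1) := by
      have : (0 : ℝ) < (2 * m).factorial := by positivity
      have : (0 : ℝ) < (m).factorial := by positivity
      rw [hch, show (2 : ℝ) ^ (4 * m) = (4 ^ m) ^ 2 by
        rw [← pow_mul, show (4 : ℝ) = 2 ^ 2 by norm_num, ← pow_mul]; congr 1; ring]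
      field_simp
    rw [e]
    calc _ ≤ π / 2 * (2 * m + 1) := by gcongr
      _ = _ := by ring
  have hpi := Real.pi_gt_three
  have hpi' := Real.pi_lt_four
  have hs : (√(π * m)) ^ 2 = π * m := Real.sq_sqrt (by positivity)
  have hs1 : 1 ≤ √(π * m) := by
    rw [Real.one_le_sqrt]; nlinarith
  have : 4 ^ m / ((2 * m).choose m : ℝ) ≤ √(π * m) + 1 := by
    refine le_of_pow_le_pow_left₀ (n := 2) (by norm_num) (by positivity) (key.trans ?_)
    nlinarith
  linarith

theorem div_sqrt_le_arcsin_sub {s t : ℝ} (hs : 0 ≤ s) (hst : s < t) (ht : t ≤ 1) :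
    (1 / √(1 - s ^ 2)) * (t - s) ≤ arcsin t - arcsin s := by
  have hne : ∀ x ∈ interior (Set.Icc s t), x ≠ -1 ∧ x ≠ 1 := by
    intro x hx
    rw [interior_Icc] at hx
    exact ⟨by linarith [hx.1], by linarith [hx.2]⟩
  refine (convex_Icc s t).mul_sub_le_image_sub_of_le_deriv
    Real.continuous_arcsin.continuousOn (fun x hx => ?_) (fun x hx => ?_) s
    (Set.left_mem_Icc.2 hst.le) t (Set.right_mem_Icc.2 hst.le) hst.le
  · exact ((Real.hasDerivAt_arcsin (hne x hx).1 (hne x hx).2).differentiableAt).differentiableWithinAt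
  · rw [(Real.hasDerivAt_arcsin (hne x hx).1 (hne x hx).2).deriv]
    rw [interior_Icc] at hx
    have h1 := hx.1; have h2 := hx.2
    have : 0 < 1 - x ^ 2 := by nlinarith
    gcongr

/-- A left Riemann sum of the increasing function `arcsin'`, bounded by a telescoping sum. The
missing first cell, where `arcsin(1/m) ≥ 1/m`, saves the `1`, which later pays for the term `j = m`.
-/
theorem sum_inv_sqrt_le {m : ℕ} (hm : 1 ≤ m) :
    ∑ j ∈ Ico 1 m, 1 / √(1 - ((j : ℝ) / m) ^ 2) ≤ m * (π / 2) - 1 := by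
  have hm' : (0 : ℝ) < m := by exact_mod_cast hm
  have h1 : ∀ j ∈ Ico 1 m, 1 / √(1 - ((j : ℝ) / m) ^ 2) ≤
      m * (arcsin (((j + 1 : ℕ) : ℝ) / m) - arcsin ((j : ℝ) / m)) := by
    intro j hj
    have hj := mem_Ico.1 hj
    have h := div_sqrt_le_arcsin_sub (s := (j : ℝ) / m) (t := ((j + 1 : ℕ) : ℝ) / m)
      (by positivity) (by gcongr; simp)
      (by rw [div_le_one hm']; exact_mod_cast hj.2)
    have e : ((j + 1 : ℕ) : ℝ) / m - (j : ℝ) / m = 1 / m := by push_cast; ring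
    rw [e] at h
    calc _ = m * (1 / √(1 - ((j : ℝ) / m) ^ 2) * (1 / m)) := by field_simp
      _ ≤ _ := by gcongr
  refine (sum_le_sum h1).trans ?_
  rw [← mul_sum, sum_Ico_sub (fun j : ℕ => arcsin ((j : ℝ) / m)) hm, div_self hm'.ne',
    arcsin_one]
  have h2 : (1 : ℝ) / m ≤ arcsin (1 / m) := by
    have h0 : (1 : ℝ) / m ≤ 1 := by rw [div_le_one hm']; exact_mod_cast hm
    have := Real.sin_le (Real.arcsin_nonneg.2 (by positivity : (0 : ℝ) ≤ 1 / m))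
    rwa [Real.sin_arcsin (by linarith [show (0 : ℝ) ≤ 1 / m by positivity]) h0] at this
  have h3 : (m : ℝ) * (1 / m) = 1 := by field_simp
  have h4 : (m : ℝ) * (1 / m) ≤ m * arcsin (1 / m) := by gcongr
  push_cast
  linarith

/-- The least `m` for which the bound `0.30812` suffices is `8`. From there on the central binomial
coefficient grows by the factor `2(2n+1)/(n+1)`, which exceeds `1/0.30812`. -/
theorem one_le_choose_mul_LamStar_pow {m : ℕ} (hm : 8 ≤ m) :
    1 ≤ ((2 * m).choose m : ℝ) * LamStar ^ m := by
  have hL := LamStar_lower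
  have hL0 : 0 < LamStar := by linarith
  suffices h : 1 ≤ (m.centralBinom : ℝ) * LamStar ^ m from h
  induction m, hm using Nat.le_induction with
  | base =>
    have : (Nat.centralBinom 8 : ℝ) = 12870 := by
      have : Nat.centralBinom 8 = 12870 := by decide
      exact_mod_cast this
    rw [this]
    calc (1 : ℝ) ≤ 12870 * 0.30812 ^ 8 := by norm_num
      _ ≤ _ := by gcongr
  | succ n hn ih =>
    have h := Nat.succ_mul_centralBinom_succ n
    have h' : ((n : ℝ) + 1) * (n + 1).centralBinom = 2 * (2 * n + 1) * n.centralBinom := by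
      exact_mod_cast h
    have hn' : (8 : ℝ) ≤ n := by exact_mod_cast hn
    have hn1 : (0 : ℝ) < (n : ℝ) + 1 := by positivity
    rw [← mul_le_mul_iff_right₀ hn1, ← mul_assoc, h', pow_succ]
    calc ((n : ℝ) + 1) * 1 ≤ (2 * (2 * n + 1) * 0.30812) * 1 := by nlinarith
      _ ≤ (2 * (2 * n + 1) * LamStar) * (n.centralBinom * LamStar ^ n) := by gcongr
      _ = _ := by ring

theorem choose_div_choose_eq {m j : ℕ} (hj : j ≤ m) :
    ((2 * m).choose (m + j) : ℝ) / ((2 * m).choose m : ℝ) =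
      (m.factorial : ℝ) ^ 2 / ((m - j).factorial * (m + j).factorial) := by
  rw [Nat.cast_choose ℝ (by omega : m ≤ 2 * m), Nat.cast_choose ℝ (by omega : m + j ≤ 2 * m),
    show 2 * m - m = m by omega, show 2 * m - (m + j) = m - j by omega]
  have h1 : (0 : ℝ) < m.factorial := by positivity
  have h2 : (0 : ℝ) < (m - j).factorial := by positivity
  have h3 : (0 : ℝ) < (m + j).factorial := by positivity
  have h4 : (0 : ℝ) < (2 * m).factorial := by positivity
  field_simp

theorem choose_div_mul_pow_le {m j : ℕ} (hj : 1 ≤ j) (hjm : j < m) :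
    ((2 * m).choose (m + j) : ℝ) / ((2 * m).choose m : ℝ) * (j : ℝ) ^ (2 * m) ≤
      (m : ℝ) ^ (2 * m) * LamStar ^ m * (1 / √(1 - ((j : ℝ) / m) ^ 2)) := by
  rw [choose_div_choose_eq hjm.le]
  -- Here `a + 1 = m - j`, and the three factorials have indices in arithmetic progression with
  -- difference `j`.
  obtain ⟨a, rfl⟩ : ∃ a, m = a + 1 + j := ⟨m - j - 1, by omega⟩
  have h := factorial_sq_div_le a j
  have hlam := Lam_pow_eq (a := a + 1) (j := j) (by omega) hj
  have hM : (0 : ℝ) < (a + 1 + j : ℕ) := by positivity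
  have hjj : (0 : ℝ) < j := by positivity
  have hmem : (j : ℝ) / (a + 1 + j : ℕ) ∈ Set.Ioo (0 : ℝ) 1 :=
    ⟨by positivity, by rw [div_lt_one hM]; exact_mod_cast hjm⟩
  have hle := Lam_le_LamStar hmem
  have h0 := Lam_nonneg hmem
  rw [show a + 1 + j - j = a + 1 by omega, show a + 1 + j + j = a + 1 + 2 * j by ring]
  have hs : ((a + 1 + j : ℕ) : ℝ) / √(((a + 1 : ℕ) : ℝ) * (a + 1 + 2 * j : ℕ)) =
      1 / √(1 - ((j : ℝ) / (a + 1 + j : ℕ)) ^ 2) := by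
    have e : 1 - ((j : ℝ) / (a + 1 + j : ℕ)) ^ 2 =
        ((a + 1 : ℕ) : ℝ) * (a + 1 + 2 * j : ℕ) / ((a + 1 + j : ℕ) : ℝ) ^ 2 := by
      field_simp
      push_cast
      ring
    rw [e, Real.sqrt_div (by positivity), Real.sqrt_sq hM.le, one_div_div]
  rw [hs] at h
  calc _ ≤ (1 / √(1 - ((j : ℝ) / (a + 1 + j : ℕ)) ^ 2) *
        (((a + 1 + j : ℕ) : ℝ) ^ (2 * (a + 1 + j)) /
          (((a + 1 : ℕ) : ℝ) ^ (a + 1) * ((a + 1 + 2 * j : ℕ) : ℝ) ^ (a + 1 + 2 * j)))) *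
          (j : ℝ) ^ (2 * (a + 1 + j)) := by gcongr
    _ = ((a + 1 + j : ℕ) : ℝ) ^ (2 * (a + 1 + j)) *
        Lam ((j : ℝ) / (a + 1 + j : ℕ)) ^ (a + 1 + j) *
        (1 / √(1 - ((j : ℝ) / (a + 1 + j : ℕ)) ^ 2)) := by rw [hlam]; ring
    _ ≤ _ := by gcongr

/-- With `X = m^(2m) Λ_*^m`, the term `j = m` costs at most `2X` and the others at most `2X(πm/2 -
1)`; the sum of the two is exactly `πmX`. -/
theorem sum_choose_mul_pow_le_of_eight_le {m : ℕ} (hm : 8 ≤ m) :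
    ∑ j ∈ Icc 1 m, 2 * (((2 * m).choose (m + j) : ℝ) / ((2 * m).choose m : ℝ)) * (j : ℝ) ^ (2 * m) ≤
      π * m * ((m : ℝ) ^ (2 * m) * LamStar ^ m) := by
  have hL0 : 0 < LamStar := by linarith [LamStar_lower]
  have hIcc : Icc 1 m = insert m (Ico 1 m) := by ext; simp; omega
  have h1 : ∑ j ∈ Ico 1 m, (((2 * m).choose (m + j) : ℝ) / ((2 * m).choose m : ℝ)) *
      (j : ℝ) ^ (2 * m) ≤ (m : ℝ) ^ (2 * m) * LamStar ^ m * (m * (π / 2) - 1) := by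
    refine (sum_le_sum fun j hj =>
      choose_div_mul_pow_le (mem_Ico.1 hj).1 (mem_Ico.1 hj).2).trans ?_
    rw [← mul_sum]
    have := sum_inv_sqrt_le (m := m) (by omega)
    gcongr
  have hc : (0 : ℝ) < (2 * m).choose m := by exact_mod_cast Nat.choose_pos (by omega)
  have h2 : (((2 * m).choose (m + m) : ℝ) / ((2 * m).choose m : ℝ)) * (m : ℝ) ^ (2 * m) ≤
      (m : ℝ) ^ (2 * m) * LamStar ^ m := by
    rw [← two_mul, Nat.choose_self, Nat.cast_one, mul_comm]
    gcongr
    rw [div_le_iff₀ hc, mul_comm]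
    exact one_le_choose_mul_LamStar_pow hm
  simp only [mul_assoc (2 : ℝ)]
  rw [← mul_sum, hIcc, sum_insert (by simp)]
  calc _ ≤ 2 * ((m : ℝ) ^ (2 * m) * LamStar ^ m +
      (m : ℝ) ^ (2 * m) * LamStar ^ m * (m * (π / 2) - 1)) := by gcongr
    _ = _ := by ring

theorem sum_choose_mul_pow_le {m : ℕ} (hm : 2 ≤ m) :
    ∑ j ∈ Icc 1 m, 2 * (((2 * m).choose (m + j) : ℝ) / ((2 * m).choose m : ℝ)) * (j : ℝ) ^ (2 * m) ≤
      π * m * ((m : ℝ) ^ (2 * m) * LamStar ^ m) := by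
  rcases le_or_gt 8 m with h | h
  · exact sum_choose_mul_pow_le_of_eight_le h
  have hL := LamStar_lower
  have hpi := Real.pi_gt_three
  have hle : (3 : ℝ) * m * ((m : ℝ) ^ (2 * m) * 0.30812 ^ m) ≤
      π * m * ((m : ℝ) ^ (2 * m) * LamStar ^ m) := by gcongr
  refine le_trans ?_ hle
  -- For `2 ≤ m ≤ 7` the crude values `π > 3` and `Λ_* ≥ 0.30812` are enough.
  interval_cases m <;> norm_num [sum_Icc_one_eq_sum_range, sum_range_succ, Nat.choose]

/-- The left side is `1`, and `1.0331` is just large enough to make `1.0331 · 3.141592 · 0.30812`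
exceed `1`. -/
theorem sum_choose_mul_pow_le_one :
    ∑ j ∈ Icc 1 (1 : ℕ), 2 * (((2 * 1).choose (1 + j) : ℝ) / ((2 * 1).choose 1 : ℝ)) * (j : ℝ) ^ (2 * 1) ≤
      1.0331 * (π * (1 : ℕ) * (((1 : ℕ) : ℝ) ^ (2 * 1) * LamStar ^ 1)) := by
  have hL := LamStar_lower
  have hpi := Real.pi_gt_d6
  have hle : (1.0331 : ℝ) * (3.141592 * 0.30812) ≤ 1.0331 * (π * LamStar) := by gcongr
  norm_num [Nat.choose] at hle ⊢
  linarith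

end AltSum

/-! ### From the multidimensional remainder bound to one-dimensional sums. -/

namespace AltSum

open Real Finset

theorem Icc_eq_piFinset {p : ℕ} {α : Type*} [PartialOrder α] [LocallyFiniteOrder α]
    [DecidableEq α] (a b : Fin p → α) :
    Icc a b = Fintype.piFinset fun r => Icc (a r) (b r) := by
  ext x; simp [Pi.le_def, forall_and]

theorem abs_gamma1_mul {m j : ℕ} (hj : 1 ≤ j) :
    |gamma1 m j| * j = 2 * (((2 * m).choose (m + j) : ℝ) / ((2 * m).choose m : ℝ)) := by
  have hj' : (0 : ℝ) < j := by exact_mod_cast hj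
  rw [gamma1, abs_mul, abs_mul, abs_pow, abs_neg, abs_one, one_pow,
    abs_of_nonneg (by positivity : (0 : ℝ) ≤ 2 / j),
    abs_of_nonneg (by positivity :
      (0 : ℝ) ≤ ((2 * m).choose (m + j) : ℝ) / ((2 * m).choose m : ℝ))]
  generalize ((2 * m).choose (m + j) : ℝ) / ((2 * m).choose m : ℝ) = q
  field_simp

theorem one_add_sum_le_prod {p : ℕ} (α : Fin p → ℕ) : 1 + ∑ r, α r ≤ ∏ r, (α r + 1) := by
  have h : ∀ s : Finset (Fin p), 1 + ∑ r ∈ s, α r ≤ ∏ r ∈ s, (α r + 1) := by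
    intro s
    induction s using Finset.induction_on with
    | empty => simp
    | insert a s ha ih =>
      rw [sum_insert ha, prod_insert ha]
      nlinarith [Nat.zero_le (α a), Nat.zero_le (∑ r ∈ s, α r)]
  exact h univ

theorem mem_multiIndices {p d : ℕ} {α : Fin p → ℕ} :
    α ∈ multiIndices p d ↔ ∑ r, α r = d := by
  simp [multiIndices]

/-- Termwise comparison with the multinomial theorem: since `∏ (α_r + 1) ≥ d + 1`, the coefficient
`1/(α+1)!` is at most the multinomial coefficient divided by `(d+1)!`. -/
theorem sum_multiIndices_div_factorial_le {p d : ℕ} (x : Fin p → ℝ) (hx : ∀ r, 0 ≤ x r) :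
    ∑ α ∈ multiIndices p d, 1 / (∏ r, ((α r + 1).factorial : ℝ)) * ∏ r, x r ^ α r ≤
      (∑ r, x r) ^ d / ((d + 1).factorial : ℝ) := by
  rw [sum_pow_eq_sum_piAntidiag, sum_div]
  refine sum_le_sum fun α hα => ?_
  have hs : ∑ r, α r = d := mem_multiIndices.1 hα
  have hP : 0 ≤ ∏ r, x r ^ α r := prod_nonneg fun r _ => pow_nonneg (hx r) _
  rw [mul_div_right_comm]
  refine mul_le_mul_of_nonneg_right ?_ hP
  have h1 : (∏ r, ((α r + 1).factorial : ℝ)) =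
      (∏ r, ((α r : ℝ) + 1)) * ∏ r, ((α r).factorial : ℝ) := by
    rw [← prod_mul_distrib]
    exact prod_congr rfl fun r _ => by rw [Nat.factorial_succ]; push_cast; ring
  have h2 : (∏ r, ((α r).factorial : ℝ)) * (Nat.multinomial univ α : ℝ) = d.factorial := by
    have := Nat.multinomial_spec univ α
    rw [hs] at this
    exact_mod_cast this
  have h3 : (d : ℝ) + 1 ≤ ∏ r, ((α r : ℝ) + 1) := by
    have := one_add_sum_le_prod α
    rw [hs, add_comm] at this
    exact_mod_cast this
  have h4 : (0 : ℝ) < ∏ r, ((α r).factorial : ℝ) := prod_pos fun r _ => by positivity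
  have h5 : (0 : ℝ) < ∏ r, ((α r : ℝ) + 1) := prod_pos fun r _ => by positivity
  rw [div_le_div_iff₀ (by rw [h1]; positivity) (by positivity), one_mul, h1, Nat.factorial_succ]
  push_cast
  rw [← h2]
  have h6 : (0 : ℝ) ≤ Nat.multinomial univ α := by positivity
  calc _ ≤ (∏ r, ((α r : ℝ) + 1)) * ((∏ r, ((α r).factorial : ℝ)) * Nat.multinomial univ α) := by
        gcongr
    _ = _ := by ring

theorem sum_pi_prod_mul_single {p : ℕ} (s : Finset ℕ) (w g : ℕ → ℝ) (r : Fin p) :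
    ∑ j ∈ Fintype.piFinset (fun _ : Fin p => s), (∏ q, w (j q)) * g (j r) =
      (∑ j ∈ s, w j) ^ (p - 1) * ∑ j ∈ s, w j * g j := by
  have h : ∀ j : Fin p → ℕ, (∏ q, w (j q)) * g (j r) =
      ∏ q, (w (j q) * if q = r then g (j q) else 1) := fun j => by
    rw [prod_mul_distrib, prod_ite_eq' univ r]; simp
  simp only [h]
  rw [← prod_univ_sum (t := fun _ : Fin p => s)
    (f := fun q j => w j * if q = r then g j else 1), ← mul_prod_erase univ _ (mem_univ r),
    mul_comm]
  congr 1
  · rw [prod_congr rfl (g := fun _ => ∑ j ∈ s, w j)]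
    · simp
    · intro q hq
      simp [ne_of_mem_erase hq]
  · simp

/-- With `w j = |γ_j| j`, the sum over `α` is at most `(∑ j_r)^(2m)/(2m+1)!`, and the power mean
inequality replaces `(∑ j_r)^(2m)` by `p^(2m-1) ∑ j_r^(2m)`. Each summand now involves one
coordinate, so the sum over `j` factors: `p - 1` copies of `∑ w j ≤ √(πm)` and one of the sum
bounded in `hB`. -/
theorem remainderBound_le_simpleBound {p m : ℕ} {c M : ℝ} (hp : 1 ≤ p) (hm : 1 ≤ m) (hM : 0 ≤ M)
    (hB : ∑ j ∈ Icc 1 m, 2 * (((2 * m).choose (m + j) : ℝ) / ((2 * m).choose m : ℝ)) *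
      (j : ℝ) ^ (2 * m) ≤ c * (π * m * ((m : ℝ) ^ (2 * m) * LamStar ^ m))) :
    remainderBound p m M ≤ simpleBound c p m M := by
  set w : ℕ → ℝ := fun j => 2 * (((2 * m).choose (m + j) : ℝ) / ((2 * m).choose m : ℝ)) with hw
  have hw0 : ∀ j, 0 ≤ w j := fun j => by simp only [hw]; positivity
  have hp' : (0 : ℝ) < p := by exact_mod_cast hp
  have hT : ∑ j ∈ Icc 1 m, w j ≤ √(π * m) := by
    rw [hw, sum_choose_div]; exact four_pow_div_choose_le hm
  have hL0 : 0 < LamStar := by linarith [LamStar_lower]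
  have h1 : ∑ α ∈ multiIndices p (2 * m), 1 / (∏ r, ((α r + 1).factorial : ℝ)) *
      ∑ j ∈ Icc (1 : Fin p → ℕ) (fun _ => m), |gammaCoeff m j| * ∏ r, (j r : ℝ) ^ (α r + 1) =
      ∑ j ∈ Fintype.piFinset (fun _ : Fin p => Icc 1 m), (∏ r, w (j r)) *
        ∑ α ∈ multiIndices p (2 * m), 1 / (∏ r, ((α r + 1).factorial : ℝ)) *
          ∏ r, (j r : ℝ) ^ α r := by
    simp only [mul_sum]
    rw [sum_comm, Icc_eq_piFinset]
    refine sum_congr rfl fun j hj => sum_congr rfl fun α _ => ?_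
    have : |gammaCoeff m j| * ∏ r, (j r : ℝ) ^ (α r + 1) =
        (∏ r, w (j r)) * ∏ r, (j r : ℝ) ^ α r := by
      rw [gammaCoeff, abs_prod, ← prod_mul_distrib, ← prod_mul_distrib]
      refine prod_congr rfl fun r _ => ?_
      have hwj : |gamma1 m (j r)| * (j r) = w (j r) :=
        abs_gamma1_mul (mem_Icc.1 (Fintype.mem_piFinset.1 hj r)).1
      rw [← hwj]
      ring
    rw [this]; ring
  have h2 : ∀ j ∈ Fintype.piFinset (fun _ : Fin p => Icc 1 m), (∏ r, w (j r)) *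
        ∑ α ∈ multiIndices p (2 * m), 1 / (∏ r, ((α r + 1).factorial : ℝ)) *
          ∏ r, (j r : ℝ) ^ α r ≤ (p : ℝ) ^ (2 * m - 1) / ((2 * m + 1).factorial : ℝ) *
            ∑ r, (∏ q, w (j q)) * (j r : ℝ) ^ (2 * m) := by
    intro j _
    have hW : 0 ≤ ∏ r, w (j r) := prod_nonneg fun r _ => hw0 _
    have h3 := sum_multiIndices_div_factorial_le (d := 2 * m) (fun r => (j r : ℝ))
      (fun r => Nat.cast_nonneg _)
    have h4 := pow_sum_le_card_mul_sum_pow (s := (univ : Finset (Fin p)))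
      (f := fun r => (j r : ℝ)) (fun r _ => Nat.cast_nonneg _) (2 * m - 1)
    rw [show 2 * m - 1 + 1 = 2 * m by omega, card_univ, Fintype.card_fin] at h4
    calc _ ≤ (∏ r, w (j r)) * (((p : ℝ) ^ (2 * m - 1) * ∑ r, (j r : ℝ) ^ (2 * m)) /
          ((2 * m + 1).factorial : ℝ)) := by
          gcongr
          exact h3.trans (by gcongr)
      _ = _ := by rw [← mul_sum]; ring
  set B := ∑ j ∈ Icc 1 m, w j * (j : ℝ) ^ (2 * m) with hBdef
  have hB0 : 0 ≤ B := sum_nonneg fun j _ => mul_nonneg (hw0 j) (by positivity)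
  have h5 : ∑ j ∈ Fintype.piFinset (fun _ : Fin p => Icc 1 m), ∑ r, (∏ q, w (j q)) *
      (j r : ℝ) ^ (2 * m) = p * ((∑ j ∈ Icc 1 m, w j) ^ (p - 1) * B) := by
    rw [sum_comm]
    rw [sum_congr rfl fun r _ => sum_pi_prod_mul_single (Icc 1 m) w
      (fun j => (j : ℝ) ^ (2 * m)) r]
    simp [hBdef]
  have hT0 : 0 ≤ ∑ j ∈ Icc 1 m, w j := sum_nonneg fun j _ => hw0 j
  have hpm : (0 : ℝ) ≤ π * m := by positivity
  have hpow : (π * m : ℝ) ^ (((p : ℝ) + 1) / 2) = √(π * m) ^ (p - 1) * (π * m) := by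
    have : (((p : ℝ) + 1) / 2) = (1 / 2) * ((p + 1 : ℕ) : ℝ) := by push_cast; ring
    rw [this, Real.rpow_mul hpm, Real.rpow_natCast, ← Real.sqrt_eq_rpow,
      show p + 1 = (p - 1) + 2 by omega, pow_add, Real.sq_sqrt hpm]
  have hk : kappa ^ (2 * m) = LamStar ^ m / 2 ^ (2 * m) := by
    rw [kappa, pow_mul, Real.sq_sqrt (by positivity), div_pow, pow_mul]; norm_num
  rw [remainderBound, simpleBound, h1, hpow, mul_pow, mul_pow, hk]
  calc _ ≤ M / 2 ^ (2 * m) * ((p : ℝ) ^ (2 * m - 1) / ((2 * m + 1).factorial : ℝ) *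
          (p * ((∑ j ∈ Icc 1 m, w j) ^ (p - 1) * B))) := by
        gcongr
        rw [← h5, mul_sum]
        exact sum_le_sum h2
    _ ≤ M / 2 ^ (2 * m) * ((p : ℝ) ^ (2 * m - 1) / ((2 * m + 1).factorial : ℝ) *
          (p * (√(π * m) ^ (p - 1) * (c * (π * m * ((m : ℝ) ^ (2 * m) * LamStar ^ m)))))) := by
        gcongr
    _ = _ := by
        rw [← mul_pow_sub_one (by omega : 2 * m ≠ 0) (p : ℝ)]
        ring

theorem remainderBound_le_of_two_le {p m : ℕ} {M : ℝ} (hp : 1 ≤ p) (hm : 2 ≤ m) (hM : 0 ≤ M) :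
    remainderBound p m M ≤ simpleBound 1.001 p m M := by
  refine remainderBound_le_simpleBound hp (by omega) hM ((sum_choose_mul_pow_le hm).trans ?_)
  have hL0 : 0 < LamStar := by linarith [LamStar_lower]
  -- For `m ≥ 2` the sum is bounded with constant `1`; `1.001` only weakens this.
  exact le_mul_of_one_le_left (by positivity) (by norm_num)

theorem remainderBound_le {p m : ℕ} {M : ℝ} (hp : 1 ≤ p) (hm : 1 ≤ m) (hM : 0 ≤ M) :
    remainderBound p m M ≤ simpleBound 1.0331 p m M := by
  refine remainderBound_le_simpleBound hp (by omega) hM ?_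
  rcases hm.eq_or_lt with rfl | hm
  · exact sum_choose_mul_pow_le_one
  have hL0 : 0 < LamStar := by linarith [LamStar_lower]
  exact (sum_choose_mul_pow_le hm).trans (le_mul_of_one_le_left (by positivity) (by norm_num))

end AltSum

/-! ### Tensor products of one-dimensional functionals: the `τ` form, telescoping, moments. -/

namespace AltSum

open Finset

section Tensor

variable {p : ℕ} {ι κ : Type*}

/-- Collecting equal arguments of `F` on a product grid makes the coefficient of each grid point a
product of one-dimensional coefficients. Thus `F` may be arbitrary, not just a product of functions
of one variable. -/
theorem sum_pi_eq_sum_points (A : Fin p → Finset ι) (a x : Fin p → ι → ℝ)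
    (Z : Fin p → Finset ℝ) (hZ : ∀ r, ∀ i ∈ A r, x r i ∈ Z r) (F : (Fin p → ℝ) → ℝ) :
    ∑ i ∈ Fintype.piFinset A, (∏ r, a r (i r)) * F (fun r => x r (i r)) =
      ∑ z ∈ Fintype.piFinset Z,
        (∏ r, ∑ i ∈ A r, a r i * if x r i = z r then 1 else 0) * F z := by
  classical
  have h1 : ∀ i ∈ Fintype.piFinset A, (∏ r, a r (i r)) * F (fun r => x r (i r)) =
      ∑ z ∈ Fintype.piFinset Z, (∏ r, a r (i r) * if x r (i r) = z r then 1 else 0) * F z := by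
    intro i hi
    rw [sum_eq_single (fun r => x r (i r))]
    · simp
    · intro z _ hz
      obtain ⟨r, hr⟩ := Function.ne_iff.1 hz
      rw [prod_eq_zero (mem_univ r), zero_mul]
      rw [if_neg (Ne.symm hr), mul_zero]
    · intro h
      exact absurd (Fintype.mem_piFinset.2 fun r => hZ r _ (Fintype.mem_piFinset.1 hi r)) h
  rw [sum_congr rfl h1, sum_comm]
  refine sum_congr rfl fun z _ => ?_
  rw [← sum_mul, prod_univ_sum]

/-- If weighted sums of values at points of the line agree coordinate by coordinate, then so do
their tensor products. -/
theorem sum_pi_congr (A : Fin p → Finset ι) (a x : Fin p → ι → ℝ)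
    (B : Fin p → Finset κ) (b y : Fin p → κ → ℝ)
    (h : ∀ r (φ : ℝ → ℝ), ∑ i ∈ A r, a r i * φ (x r i) = ∑ k ∈ B r, b r k * φ (y r k))
    (F : (Fin p → ℝ) → ℝ) :
    ∑ i ∈ Fintype.piFinset A, (∏ r, a r (i r)) * F (fun r => x r (i r)) =
      ∑ k ∈ Fintype.piFinset B, (∏ r, b r (k r)) * F (fun r => y r (k r)) := by
  classical
  rw [sum_pi_eq_sum_points A a x (fun r => (A r).image (x r) ∪ (B r).image (y r)),
    sum_pi_eq_sum_points B b y (fun r => (A r).image (x r) ∪ (B r).image (y r))]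
  · refine sum_congr rfl fun z _ => ?_
    congr 1
    -- Testing the one-dimensional identity on the indicator of a point compares the coefficients.
    exact prod_congr rfl fun r _ => h r (fun t => if t = z r then 1 else 0)
  · exact fun r k hk => mem_union_right _ (mem_image_of_mem _ hk)
  · exact fun r k hk => mem_union_left _ (mem_image_of_mem _ hk)

theorem sum_pi_sigma (A : Fin p → Finset ι) (R : Fin p → ι → Finset κ)
    (H : (Fin p → ι) → (Fin p → κ) → ℝ) :
    ∑ j ∈ Fintype.piFinset A, ∑ i ∈ Fintype.piFinset (fun r => R r (j r)), H j i =
      ∑ q ∈ Fintype.piFinset (fun r => (A r).sigma (R r)),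
        H (fun r => (q r).1) (fun r => (q r).2) := by
  rw [sum_sigma']
  refine sum_bij' (fun q _ r => ⟨q.1 r, q.2 r⟩) (fun q _ => ⟨fun r => (q r).1, fun r => (q r).2⟩)
    ?_ ?_ ?_ ?_ ?_
  · intro q hq
    simp only [mem_sigma, Fintype.mem_piFinset] at hq ⊢
    exact fun r => ⟨hq.1 r, hq.2 r⟩
  · intro q hq
    simp only [mem_sigma, Fintype.mem_piFinset] at hq ⊢
    exact ⟨fun r => (hq r).1, fun r => (hq r).2⟩
  · intro q _; rfl
  · intro q _; rfl
  · intro q _; rfl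

end Tensor

theorem AJ_eq_sum_sigma {p : ℕ} (l : ℕ) (F : (Fin p → ℝ) → ℝ) (J : Finset (Fin p))
    (n : Fin p → ℕ) :
    AJ l F J n = ∑ q ∈ Fintype.piFinset (fun _ : Fin p => (Icc 1 l).sigma range),
      (∏ r, gamma1 l (q r).1) *
        F (fun r => restrictTo J n r - 1 + ((q r).1 : ℝ) / 2 - ((q r).2 : ℝ)) := by
  rw [AJ, Icc_eq_piFinset]
  simp only [mul_sum, box, gammaCoeff]
  exact sum_pi_sigma (fun _ : Fin p => Icc 1 l) (fun _ => range)
    (fun j i => (∏ r, gamma1 l (j r)) *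
      F (fun r => restrictTo J n r - 1 + (j r : ℝ) / 2 - (i r : ℝ)))

theorem sum_gamma1_eq_sum_tau1 (l : ℕ) (c : ℝ) (φ : ℝ → ℝ) :
    ∑ q ∈ (Icc 1 l).sigma range, gamma1 l q.1 * φ (c - 1 + (q.1 : ℝ) / 2 - (q.2 : ℝ)) =
      ∑ β ∈ Icc (1 - (l : ℤ)) ((l : ℤ) - 1),
        tau1 l (1 + β.natAbs) * φ (c - 1 / 2 - (β : ℝ) / 2) := by
  simp only [tau1, sum_mul]
  rw [sum_sigma']
  -- The argument of `φ` depends on `(j, i)` only through `β = 2i + 1 - j`. For fixed `β` the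
  -- admissible `j` are `1 + |β| + 2b`, which are the indices collected in `tau1`.
  refine sum_bij'
    (fun q _ => ⟨2 * (q.2 : ℤ) + 1 - q.1, (q.1 - 1 - (2 * (q.2 : ℤ) + 1 - q.1).natAbs) / 2⟩)
    (fun q _ => ⟨1 + q.1.natAbs + 2 * q.2, ((q.1 + q.1.natAbs + 2 * q.2) / 2).toNat⟩)
    ?_ ?_ ?_ ?_ ?_
  · rintro ⟨j, i⟩ h
    simp only [mem_sigma, mem_Icc, mem_range] at h ⊢
    omega
  · rintro ⟨β, b⟩ h
    simp only [mem_sigma, mem_Icc, mem_range] at h ⊢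
    omega
  · rintro ⟨j, i⟩ h
    simp only [mem_sigma, mem_Icc, mem_range, Sigma.mk.injEq, heq_eq_eq] at h ⊢
    omega
  · rintro ⟨β, b⟩ h
    simp only [mem_sigma, mem_Icc, mem_range, Sigma.mk.injEq, heq_eq_eq] at h ⊢
    omega
  · rintro ⟨j, i⟩ h
    simp only [mem_sigma, mem_Icc, mem_range] at h
    have e1 : 1 + (2 * (i : ℤ) + 1 - j).natAbs +
        2 * ((j - 1 - (2 * (i : ℤ) + 1 - j).natAbs) / 2) = j := by omega
    have e2 : c - 1 / 2 - ((2 * (i : ℤ) + 1 - j : ℤ) : ℝ) / 2 = c - 1 + (j : ℝ) / 2 - i := by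
      push_cast; ring
    simp only [e1, e2]

theorem AJ_eq_sum_tau {p : ℕ} (l : ℕ) (F : (Fin p → ℝ) → ℝ) (J : Finset (Fin p))
    (n : Fin p → ℕ) :
    AJ l F J n = ∑ β ∈ Icc (fun _ : Fin p => 1 - (l : ℤ)) (fun _ => (l : ℤ) - 1),
      tauCoeff l (fun r => 1 + (β r).natAbs) *
        F (fun r => restrictTo J n r - 1 / 2 - (β r : ℝ) / 2) := by
  have h := sum_pi_congr (fun _ : Fin p => (Icc 1 l).sigma range)
    (fun _ (q : Σ _ : ℕ, ℕ) => gamma1 l q.1)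
    (fun r (q : Σ _ : ℕ, ℕ) => restrictTo J n r - 1 + (q.1 : ℝ) / 2 - (q.2 : ℝ))
    (fun _ : Fin p => Icc (1 - (l : ℤ)) ((l : ℤ) - 1))
    (fun _ (β : ℤ) => tau1 l (1 + β.natAbs))
    (fun r (β : ℤ) => restrictTo J n r - 1 / 2 - (β : ℝ) / 2)
    (fun r φ => sum_gamma1_eq_sum_tau1 l (restrictTo J n r) φ) F
  rw [AJ_eq_sum_sigma, h, Icc_eq_piFinset]
  rfl

theorem mem_absFiber {p : ℕ} {α : Fin p → ℕ} {β : Fin p → ℤ} :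
    β ∈ absFiber α ↔ ∀ r, (β r).natAbs = α r := by
  simp only [absFiber, mem_filter, mem_Icc, Pi.le_def, and_iff_right_iff_imp]
  intro h
  constructor <;> intro r <;> have := h r <;> omega

theorem sum_abs_fiberwise {p : ℕ} {l : ℕ} (hl : 1 ≤ l) (w : (Fin p → ℕ) → ℝ)
    (G : (Fin p → ℤ) → ℝ) :
    ∑ β ∈ Icc (fun _ : Fin p => 1 - (l : ℤ)) (fun _ => (l : ℤ) - 1),
      w (fun r => (β r).natAbs) * G β =
    ∑ α ∈ Icc (0 : Fin p → ℕ) (fun _ => l - 1), w α * ∑ β ∈ absFiber α, G β := by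
  rw [← sum_fiberwise_of_maps_to (t := Icc (0 : Fin p → ℕ) (fun _ => l - 1))
    (g := fun β : Fin p → ℤ => fun r => (β r).natAbs)]
  · refine sum_congr rfl fun α hα => ?_
    rw [mul_sum]
    simp only [mem_Icc, Pi.le_def] at hα
    have hs : (Icc (fun _ : Fin p => 1 - (l : ℤ)) (fun _ => (l : ℤ) - 1)).filter
        (fun β => (fun r => (β r).natAbs) = α) = absFiber α := by
      ext β
      simp only [mem_filter, mem_absFiber, mem_Icc, Pi.le_def, funext_iff, and_iff_right_iff_imp]
      intro h
      constructor <;> intro r <;> have := h r <;> have := hα.2 r <;> omega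
    rw [hs]
    refine sum_congr rfl fun β hβ => ?_
    rw [show (fun r => (β r).natAbs) = α from funext (mem_absFiber.1 hβ)]
  · intro β hβ
    simp only [mem_Icc, Pi.le_def] at hβ ⊢
    refine ⟨fun r => Nat.zero_le _, fun r => ?_⟩
    have := hβ.1 r; have := hβ.2 r
    omega

theorem AJ_eq_sum_absFiber {p : ℕ} {l : ℕ} (hl : 1 ≤ l) (F : (Fin p → ℝ) → ℝ)
    (J : Finset (Fin p)) (n : Fin p → ℕ) :
    AJ l F J n = ∑ α ∈ Icc (0 : Fin p → ℕ) (fun _ => l - 1), tauCoeff l (fun r => 1 + α r) *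
      ∑ β ∈ absFiber α, F (fun r => restrictTo J n r - 1 / 2 - (β r : ℝ) / 2) := by
  rw [AJ_eq_sum_tau]
  exact sum_abs_fiberwise hl (fun α => tauCoeff l (fun r => 1 + α r)) _

theorem restrictTo_empty {p : ℕ} (n : Fin p → ℕ) : restrictTo ∅ n = 0 := by
  ext r; simp [restrictTo]

theorem restrictTo_zero {p : ℕ} (J : Finset (Fin p)) : restrictTo J 0 = 0 := by
  ext r; simp [restrictTo]

theorem AJ_empty {p : ℕ} (l : ℕ) (F : (Fin p → ℝ) → ℝ) (n : Fin p → ℕ) :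
    AJ l F ∅ 0 = AJ l F ∅ n := by
  simp only [AJ, restrictTo_empty]

theorem AJ_zero {p : ℕ} (l : ℕ) (F : (Fin p → ℝ) → ℝ) (J : Finset (Fin p)) :
    AJ l F ∅ 0 = AJ l F J 0 := by
  simp only [AJ, restrictTo_zero]

theorem AJ_empty_eq_sum {p : ℕ} {l : ℕ} (hl : 1 ≤ l) (F : (Fin p → ℝ) → ℝ) :
    AJ l F ∅ 0 = ∑ α ∈ Icc (0 : Fin p → ℕ) (fun _ => l - 1), tauCoeff l (fun r => 1 + α r) *
      ∑ β ∈ absFiber α, F (fun r => (β r : ℝ) / 2 - 1 / 2) := by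
  rw [AJ_eq_sum_absFiber hl]
  refine sum_congr rfl fun α _ => ?_
  congr 1
  -- At `n = 0` the shift vanishes, and the fibre of `|β| = α` is symmetric under `β ↦ -β`.
  refine sum_bij' (fun β _ => -β) (fun β _ => -β) ?_ ?_ ?_ ?_ ?_
  · intro β hβ; rw [mem_absFiber] at hβ ⊢; simpa using hβ
  · intro β hβ; rw [mem_absFiber] at hβ ⊢; simpa using hβ
  · intro β _; simp
  · intro β _; simp
  · intro β _
    congr 1
    ext r
    simp only [restrictTo_zero, Pi.zero_apply, Pi.neg_apply, Int.cast_neg]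
    ring

/-- A difference over a step of length `j` is a sum of `j` unit differences, and each of these
telescopes in `k`. -/
theorem sum_range_sub_half (j n : ℕ) (φ : ℝ → ℝ) :
    ∑ k ∈ range n, (φ (k + (j : ℝ) / 2) - φ (k - (j : ℝ) / 2)) =
      ∑ i ∈ range j, (φ (n - 1 + (j : ℝ) / 2 - i) - φ (0 - 1 + (j : ℝ) / 2 - i)) := by
  induction n with
  | zero => simp
  | succ n ih =>
    rw [sum_range_succ, ih]
    have h := sum_range_sub' (fun i : ℕ => φ (n + (j : ℝ) / 2 - i)) j
    have e : φ (n + (j : ℝ) / 2) - φ (n - (j : ℝ) / 2) =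
        ∑ i ∈ range j, (φ (n + (j : ℝ) / 2 - i) - φ (n - 1 + (j : ℝ) / 2 - i)) := by
      simp only [Nat.cast_zero, sub_zero] at h
      rw [show (n : ℝ) - (j : ℝ) / 2 = n + (j : ℝ) / 2 - j by ring, ← h]
      refine sum_congr rfl fun i _ => ?_
      congr 2
      push_cast; ring
    rw [e, ← sum_add_distrib]
    refine sum_congr rfl fun i _ => ?_
    rw [show ((n + 1 : ℕ) : ℝ) - 1 + (j : ℝ) / 2 - i = n + (j : ℝ) / 2 - i by push_cast; ring]
    ring

/-- Encoding `J` as a Boolean vector turns the sign into a product over coordinates, as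
`sum_pi_congr` requires. -/
theorem sum_finset_sign_eq {p : ℕ} (H : (Fin p → Bool) → ℝ) :
    ∑ J : Finset (Fin p), (-1 : ℝ) ^ (p - J.card) * H (fun r => decide (r ∈ J)) =
      ∑ ε ∈ Fintype.piFinset (fun _ : Fin p => (univ : Finset Bool)),
        (∏ r, if ε r then (1 : ℝ) else -1) * H ε := by
  refine sum_bij' (fun J _ r => decide (r ∈ J)) (fun ε _ => univ.filter fun r => ε r = true)
    ?_ ?_ ?_ ?_ ?_
  · exact fun J _ => Fintype.mem_piFinset.2 fun r => mem_univ _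
  · simp
  · intro J _; ext; simp
  · intro ε _; ext; simp
  · intro J _
    congr 1
    simp only [decide_eq_true_eq]
    rw [prod_ite, prod_const_one, one_mul, prod_const]
    congr 1
    rw [filter_not, filter_mem_eq_inter, univ_inter, ← compl_eq_univ_sdiff, card_compl,
      Fintype.card_fin]

theorem sum_sign_sum_box_eq {p : ℕ} (F : (Fin p → ℝ) → ℝ) (j n : Fin p → ℕ) :
    ∑ J : Finset (Fin p), (-1 : ℝ) ^ (p - J.card) * ∑ k ∈ box n,
      F (fun r => k r + if r ∈ J then (j r : ℝ) / 2 else -((j r : ℝ) / 2)) =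
    ∑ J : Finset (Fin p), (-1 : ℝ) ^ (p - J.card) * ∑ i ∈ box j,
      F (fun r => restrictTo J n r - 1 + (j r : ℝ) / 2 - i r) := by
  have h1 := sum_finset_sign_eq (fun ε : Fin p → Bool => ∑ k ∈ box n,
      F (fun r => k r + if ε r then (j r : ℝ) / 2 else -((j r : ℝ) / 2)))
  have h2 := sum_finset_sign_eq (fun ε : Fin p → Bool => ∑ i ∈ box j,
      F (fun r => (if ε r then (n r : ℝ) else 0) - 1 + (j r : ℝ) / 2 - i r))
  simp only [decide_eq_true_eq] at h1 h2
  simp only [restrictTo]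
  rw [h1, h2]
  simp only [mul_sum, box]
  rw [sum_pi_sigma (fun _ : Fin p => (univ : Finset Bool)) (fun r _ => range (n r))
      (fun ε k => (∏ r, if ε r then (1 : ℝ) else -1) *
        F (fun r => k r + if ε r then (j r : ℝ) / 2 else -((j r : ℝ) / 2))),
    sum_pi_sigma (fun _ : Fin p => (univ : Finset Bool)) (fun r _ => range (j r))
      (fun ε i => (∏ r, if ε r then (1 : ℝ) else -1) *
        F (fun r => (if ε r then (n r : ℝ) else 0) - 1 + (j r : ℝ) / 2 - i r))]
  refine sum_pi_congr _ (fun _ (q : Σ _ : Bool, ℕ) => if q.1 then (1 : ℝ) else -1)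
    (fun r (q : Σ _ : Bool, ℕ) => q.2 + if q.1 then (j r : ℝ) / 2 else -((j r : ℝ) / 2)) _
    (fun _ (q : Σ _ : Bool, ℕ) => if q.1 then (1 : ℝ) else -1)
    (fun r (q : Σ _ : Bool, ℕ) => (if q.1 then (n r : ℝ) else 0) - 1 + (j r : ℝ) / 2 - q.2) (fun r φ => ?_) F
  rw [sum_sigma, sum_sigma]
  have := sum_range_sub_half (j r) (n r) φ
  rw [sum_sub_distrib, sum_sub_distrib] at this
  simp only [Fintype.sum_bool, if_true, Bool.false_eq_true, if_false, one_mul, neg_mul,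
    sum_neg_distrib, ← sub_eq_add_neg]
  exact this

/-- The `2l`-th finite difference of `x^a`, started at `-l`, vanishes. For even `a` its terms at
`±j` agree and give a multiple of `γ_{l,j} j^(a+1)`, while the middle term carries `0^a`, the right
side. -/
theorem sum_gamma1_mul_pow {l a : ℕ} (ha : Even a) (hal : a < 2 * l) :
    ∑ j ∈ Icc 1 l, gamma1 l j * (j : ℝ) ^ (a + 1) = if a = 0 then 1 else 0 := by
  have h := congrFun (fwdDiff_iter_pow_eq_zero_of_lt (R := ℝ) hal) (-(l : ℝ))
  rw [fwdDiff_iter_eq_sum_shift, Pi.zero_apply] at h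
  simp only [zsmul_eq_mul, nsmul_eq_mul, mul_one] at h
  rw [sum_range_two_mul_add_one (fun k => (((-1 : ℤ) ^ (2 * l - k) * ((2 * l).choose k : ℤ) : ℤ) : ℝ)
    * (-(l : ℝ) + k) ^ a)] at h
  have hc : (0 : ℝ) < (2 * l).choose l := by exact_mod_cast Nat.choose_pos (by omega)
  have hterm : ∀ j ∈ Icc 1 l,
      (((-1 : ℤ) ^ (2 * l - (l + j)) * ((2 * l).choose (l + j) : ℤ) : ℤ) : ℝ) *
        (-(l : ℝ) + (l + j : ℕ)) ^ a +
      (((-1 : ℤ) ^ (2 * l - (l - j)) * ((2 * l).choose (l - j) : ℤ) : ℤ) : ℝ) *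
        (-(l : ℝ) + (l - j : ℕ)) ^ a =
      -((-1) ^ l * (2 * l).choose l * (gamma1 l j * (j : ℝ) ^ (a + 1))) := by
    intro j hj
    obtain ⟨hj1, hjl⟩ := mem_Icc.1 hj
    obtain ⟨i, rfl⟩ : ∃ i, j = i + 1 := ⟨j - 1, by omega⟩
    obtain ⟨b, rfl⟩ : ∃ b, l = b + (i + 1) := ⟨l - (i + 1), by omega⟩
    rw [choose_sub_eq hjl]
    have e1 : -((b + (i + 1) : ℕ) : ℝ) + ((b + (i + 1) - (i + 1) : ℕ) : ℝ) = -((i + 1 : ℕ) : ℝ) := by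
      rw [Nat.add_sub_cancel]; push_cast; ring
    have e2 : -((b + (i + 1) : ℕ) : ℝ) + ((b + (i + 1) + (i + 1) : ℕ) : ℝ) = ((i + 1 : ℕ) : ℝ) := by
      push_cast; ring
    rw [e1, e2, ha.neg_pow, gamma1,
      show 2 * (b + (i + 1)) - (b + (i + 1) + (i + 1)) = b by omega,
      show 2 * (b + (i + 1)) - (b + (i + 1) - (i + 1)) = b + 2 * (i + 1) by omega,
      Nat.add_sub_cancel]
    have hi : (0 : ℝ) < ((i + 1 : ℕ) : ℝ) := by positivity
    generalize ((i + 1 : ℕ) : ℝ) = x at *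
    push_cast
    have s1 : (-1 : ℝ) ^ (b + 2 * (i + 1)) = (-1) ^ b := by
      rw [pow_add, pow_mul]; simp
    have s2 : (-1 : ℝ) ^ (b + (i + 1)) * (-1) ^ i = -(-1) ^ b := by
      rw [← pow_add, show b + (i + 1) + i = b + 2 * i + 1 by ring, pow_succ, pow_add, pow_mul]
      simp
    rw [s1]
    calc _ = -(-(-1 : ℝ) ^ b) * 2 * (2 * (b + (i + 1))).choose (b + (i + 1) + (i + 1)) * x ^ a := by
          ring
      _ = _ := by rw [← s2]; field_simp; ring
  rw [sum_congr rfl hterm, sum_neg_distrib, ← mul_sum,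
    show 2 * l - l = l by omega, neg_add_cancel] at h
  have hs : (-1 : ℝ) ^ l ≠ 0 := by simp
  have h0 : (-1 : ℝ) ^ l * (2 * l).choose l *
      ((0 : ℝ) ^ a - ∑ j ∈ Icc 1 l, gamma1 l j * (j : ℝ) ^ (a + 1)) = 0 := by
    push_cast at h
    linear_combination h
  have := (mul_eq_zero.1 h0).resolve_left (mul_ne_zero hs hc.ne')
  rw [← sub_eq_zero.1 this, zero_pow_eq]

theorem sum_gamma1_mul_pow_sub {l a : ℕ} (hal : a ≤ 2 * l) :
    ∑ j ∈ Icc 1 l, gamma1 l j * (((j : ℝ) / 2) ^ a - (-((j : ℝ) / 2)) ^ a) =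
      if a = 1 then 1 else 0 := by
  rcases Nat.even_or_odd a with ha | ha
  · rw [if_neg (by rintro rfl; exact absurd ha (by decide))]
    exact sum_eq_zero fun j _ => by rw [ha.neg_pow, sub_self, mul_zero]
  · obtain ⟨b, rfl⟩ := ha
    have h := sum_gamma1_mul_pow (l := l) (a := 2 * b) (even_two_mul b) (by omega)
    have h2 : ∀ j ∈ Icc 1 l, gamma1 l j * (((j : ℝ) / 2) ^ (2 * b + 1) -
        (-((j : ℝ) / 2)) ^ (2 * b + 1)) =
        (1 / 2 ^ (2 * b)) * (gamma1 l j * (j : ℝ) ^ (2 * b + 1)) := by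
      intro j _
      rw [(odd_two_mul_add_one b).neg_pow, div_pow, pow_succ (2 : ℝ)]
      field_simp
      ring
    rw [sum_congr rfl h2, ← mul_sum, h]
    by_cases hb : b = 0
    · simp [hb]
    · rw [if_neg (by omega), if_neg (by omega), mul_zero]

theorem sum_gamma1_mul_eval_sub {l : ℕ} (Q : Polynomial ℝ) (hQ : Q.natDegree ≤ 2 * l)
    (hl : 1 ≤ l) :
    ∑ j ∈ Icc 1 l, gamma1 l j * (Q.eval ((j : ℝ) / 2) - Q.eval (-((j : ℝ) / 2))) =
      Q.coeff 1 := by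
  simp only [Polynomial.eval_eq_sum_range' (Nat.lt_succ_of_le hQ), ← sum_sub_distrib, mul_sum]
  rw [sum_comm]
  have h : ∀ a ∈ range (2 * l).succ, ∑ j ∈ Icc 1 l,
      gamma1 l j * (Q.coeff a * ((j : ℝ) / 2) ^ a - Q.coeff a * (-((j : ℝ) / 2)) ^ a) =
      if a = 1 then Q.coeff a else 0 := by
    intro a ha
    have := sum_gamma1_mul_pow_sub (l := l) (a := a) (by have := mem_range.1 ha; omega)
    have h3 : (if a = 1 then Q.coeff a else 0) = Q.coeff a * if a = 1 then 1 else 0 := by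
      split_ifs <;> simp
    rw [h3, ← this, mul_sum]
    exact sum_congr rfl fun j _ => by ring
  rw [sum_congr rfl h, sum_ite_eq' _ 1, if_pos (mem_range.2 (by omega))]

/-- `Q(x) = B_{a+1}(x + 1/2)/(a+1)`, from the difference equation of the Bernoulli polynomials. -/
theorem exists_polynomial_sub_eq_pow (a : ℕ) :
    ∃ Q : Polynomial ℝ, Q.natDegree ≤ a + 1 ∧
      ∀ x : ℝ, Q.eval (x + 1 / 2) - Q.eval (x - 1 / 2) = x ^ a := by
  have hb := Polynomial.bernoulli_comp_one_add_X (a + 1)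
  have hb' := congrArg (Polynomial.map (algebraMap ℚ ℝ)) hb
  rw [Polynomial.map_comp] at hb'
  refine ⟨Polynomial.C (1 / ((a : ℝ) + 1)) *
    ((Polynomial.bernoulli (a + 1)).map (algebraMap ℚ ℝ)).comp
      (Polynomial.X + Polynomial.C (1 / 2)), ?_, fun x => ?_⟩
  · refine (Polynomial.natDegree_C_mul_le _ _).trans ?_
    rw [Polynomial.natDegree_comp, Polynomial.natDegree_X_add_C, mul_one]
    refine Polynomial.natDegree_map_le.trans ?_
    refine Polynomial.natDegree_le_iff_coeff_eq_zero.2 fun N hN => ?_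
    rw [Polynomial.coeff_bernoulli, if_neg (by omega)]
  · have h := congrArg (Polynomial.eval x) hb'
    simp only [Polynomial.map_add, Polynomial.map_one, Polynomial.map_X, Polynomial.eval_comp,
      Polynomial.eval_add, Polynomial.eval_one, Polynomial.eval_X, nsmul_eq_mul,
      Polynomial.map_mul, Polynomial.map_natCast, Polynomial.map_pow, Polynomial.eval_mul,
      Polynomial.eval_natCast, Polynomial.eval_pow, Nat.add_sub_cancel] at h
    have ha : (0 : ℝ) < (a : ℝ) + 1 := by positivity
    simp only [Polynomial.eval_mul, Polynomial.eval_C, Polynomial.eval_comp, Polynomial.eval_add,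
      Polynomial.eval_X]
    rw [show x + 1 / 2 + 1 / 2 = 1 + x by ring, show x - 1 / 2 + 1 / 2 = x by ring]
    rw [h]; push_cast; field_simp; ring

/-- The moments of the functional `A` do not depend on its order, as long as that is large. -/
theorem sum_gamma1_moment_eq {l l' a : ℕ} (h : a < 2 * l) (h' : a < 2 * l') :
    ∑ j ∈ Icc 1 l, gamma1 l j * ∑ i ∈ range j, (-(1 / 2) + (j : ℝ) / 2 - i) ^ a =
    ∑ j ∈ Icc 1 l', gamma1 l' j * ∑ i ∈ range j, (-(1 / 2) + (j : ℝ) / 2 - i) ^ a := by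
  obtain ⟨Q, hQ, hQx⟩ := exists_polynomial_sub_eq_pow a
  -- The inner sum telescopes to `Q(j/2) - Q(-j/2)`, and the weights of order `k` turn these
  -- differences into `Q'(0)`, in which `k` no longer occurs.
  have key : ∀ k : ℕ, a < 2 * k → ∑ j ∈ Icc 1 k, gamma1 k j *
      ∑ i ∈ range j, (-(1 / 2) + (j : ℝ) / 2 - i) ^ a = Q.coeff 1 := by
    intro k hk
    rw [← sum_gamma1_mul_eval_sub (l := k) Q (by omega) (by omega)]
    refine sum_congr rfl fun j _ => ?_
    congr 1
    have ht := sum_range_sub' (fun i : ℕ => Q.eval ((j : ℝ) / 2 - i)) j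
    simp only [Nat.cast_zero, sub_zero] at ht
    rw [show -((j : ℝ) / 2) = (j : ℝ) / 2 - j by ring, ← ht]
    refine sum_congr rfl fun i _ => ?_
    rw [← hQx]
    congr 2 <;> push_cast <;> ring
  rw [key l h, key l' h']

end AltSum

/-! ### Mixed partial derivatives and the multivariate Taylor formula. -/

namespace AltSum

open Finset

section Derivatives

variable {p : ℕ}

theorem partialDeriv_eq_fderiv {g : (Fin p → ℝ) → ℝ} (hg : Differentiable ℝ g) (r : Fin p) :
    partialDeriv r g = fun x => fderiv ℝ g x (Pi.single r 1) := by
  ext x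
  exact (hg x).lineDeriv_eq_fderiv

theorem contDiff_partialDeriv {g : (Fin p → ℝ) → ℝ} {n : ℕ}
    (hg : ContDiff ℝ ((n + 1 : ℕ) : WithTop ℕ∞) g) (r : Fin p) :
    ContDiff ℝ (n : WithTop ℕ∞) (partialDeriv r g) := by
  rw [partialDeriv_eq_fderiv (hg.differentiable (by simp))]
  exact (hg.fderiv_right (m := (n : WithTop ℕ∞)) (by norm_cast)).clm_apply contDiff_const

theorem partialDeriv_comm {g : (Fin p → ℝ) → ℝ} (hg : ContDiff ℝ ((2 : ℕ) : WithTop ℕ∞) g)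
    (r q : Fin p) : partialDeriv r (partialDeriv q g) = partialDeriv q (partialDeriv r g) := by
  have h1 : ∀ q, Differentiable ℝ (partialDeriv q g) := fun q =>
    (contDiff_partialDeriv (n := 1) hg q).differentiable (by simp)
  have hd : Differentiable ℝ (fderiv ℝ g) :=
    (hg.fderiv_right (m := ((1 : ℕ) : WithTop ℕ∞)) (by norm_cast)).differentiable (by simp)
  rw [partialDeriv_eq_fderiv (h1 q), partialDeriv_eq_fderiv (h1 r)]
  have hg0 : Differentiable ℝ g := hg.differentiable (by simp)
  rw [partialDeriv_eq_fderiv hg0, partialDeriv_eq_fderiv hg0]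
  ext x
  have hsymm : IsSymmSndFDerivAt ℝ g x :=
    hg.contDiffAt.isSymmSndFDerivAt (by simp)
  rw [fderiv_clm_apply (hd x) (by fun_prop), fderiv_clm_apply (hd x) (by fun_prop)]
  simpa using hsymm.eq (Pi.single r 1) (Pi.single q 1)

theorem contDiff_iterate_partialDeriv {g : (Fin p → ℝ) → ℝ} {n a : ℕ}
    (hg : ContDiff ℝ ((n + a : ℕ) : WithTop ℕ∞) g) (r : Fin p) :
    ContDiff ℝ (n : WithTop ℕ∞) ((partialDeriv r)^[a] g) := by
  induction a generalizing n with
  | zero => exact hg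
  | succ a ih =>
    rw [Function.iterate_succ_apply']
    refine contDiff_partialDeriv (ih ?_) r
    rwa [show n + 1 + a = n + (a + 1) by ring]

theorem partialDeriv_iterate_comm {g : (Fin p → ℝ) → ℝ} {a : ℕ}
    (hg : ContDiff ℝ ((a + 1 : ℕ) : WithTop ℕ∞) g) (r q : Fin p) :
    partialDeriv r ((partialDeriv q)^[a] g) = (partialDeriv q)^[a] (partialDeriv r g) := by
  induction a with
  | zero => rfl
  | succ a ih =>
    rw [Function.iterate_succ_apply', Function.iterate_succ_apply', partialDeriv_comm, ih]
    · exact hg.of_le (by norm_cast; omega)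
    · refine contDiff_iterate_partialDeriv ?_ q
      rwa [show 2 + a = a + 1 + 1 by ring]

/-- The iterated partial derivative along the coordinates in a list. -/
noncomputable def multiDerivOn (L : List (Fin p)) (α : Fin p → ℕ) (g : (Fin p → ℝ) → ℝ) : (Fin p → ℝ) → ℝ :=
  L.foldr (fun r h => (partialDeriv r)^[α r] h) g

theorem contDiff_multiDerivOn {g : (Fin p → ℝ) → ℝ} {α : Fin p → ℕ} (L : List (Fin p)) {n : ℕ}
    (hg : ContDiff ℝ ((n + (L.map α).sum : ℕ) : WithTop ℕ∞) g) :
    ContDiff ℝ (n : WithTop ℕ∞) (multiDerivOn L α g) := by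
  induction L generalizing n with
  | nil => simpa [multiDerivOn] using hg
  | cons q L ih =>
    refine contDiff_iterate_partialDeriv (ih ?_) q
    rw [List.map_cons, List.sum_cons, ← add_assoc] at hg
    exact hg

/-- By symmetry of second derivatives, `∂_r` moves inward past the other coordinates until it meets
its own block; `Nodup` ensures that there is only one. -/
theorem partialDeriv_multiDerivOn {g : (Fin p → ℝ) → ℝ} {α : Fin p → ℕ} (L : List (Fin p))
    (hL : L.Nodup) {r : Fin p} (hr : r ∈ L)
    (hg : ContDiff ℝ (((L.map α).sum + 1 : ℕ) : WithTop ℕ∞) g) :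
    partialDeriv r (multiDerivOn L α g) = multiDerivOn L (α + Pi.single r 1) g := by
  induction L with
  | nil => simp at hr
  | cons q L ih =>
    rw [List.nodup_cons] at hL
    rw [List.map_cons, List.sum_cons] at hg
    change partialDeriv r ((partialDeriv q)^[α q] (multiDerivOn L α g)) =
      (partialDeriv q)^[(α + Pi.single r 1 : Fin p → ℕ) q] (multiDerivOn L (α + Pi.single r 1) g)
    by_cases hq : r = q
    · subst hq
      have : multiDerivOn L (α + Pi.single r 1) g = multiDerivOn L α g := by
        refine List.foldr_ext _ _ _ fun s hs h => ?_
        have : s ≠ r := fun h => hL.1 (h ▸ hs)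
        simp [this]
      rw [this, Pi.add_apply, Pi.single_eq_same, Function.iterate_succ_apply']
    · have hr' : r ∈ L := (List.mem_cons.1 hr).resolve_left hq
      rw [partialDeriv_iterate_comm, ih hL.2 hr', Pi.add_apply,
        Pi.single_eq_of_ne (Ne.symm hq), add_zero]
      · exact hg.of_le (by norm_cast; omega)
      · refine contDiff_multiDerivOn L ?_
        rwa [show α q + 1 + (L.map α).sum = α q + (L.map α).sum + 1 by ring]

theorem sum_map_finRange (α : Fin p → ℕ) : ((List.finRange p).map α).sum = ∑ r, α r := by
  rw [← List.sum_ofFn, List.ofFn_eq_map]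

theorem contDiff_multiDeriv {g : (Fin p → ℝ) → ℝ} {α : Fin p → ℕ} {n : ℕ}
    (hg : ContDiff ℝ ((n + ∑ r, α r : ℕ) : WithTop ℕ∞) g) :
    ContDiff ℝ (n : WithTop ℕ∞) (multiDeriv α g) :=
  contDiff_multiDerivOn (List.finRange p) (by rwa [sum_map_finRange])

theorem continuous_multiDeriv {g : (Fin p → ℝ) → ℝ} {α : Fin p → ℕ} {N : ℕ}
    (hg : ContDiff ℝ (N : WithTop ℕ∞) g) (hα : ∑ r, α r = N) :
    Continuous (multiDeriv α g) := by
  refine (contDiff_multiDeriv (n := 0) ?_).continuous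
  rwa [zero_add, hα]

theorem partialDeriv_multiDeriv {g : (Fin p → ℝ) → ℝ} {α : Fin p → ℕ}
    (hg : ContDiff ℝ ((∑ r, α r + 1 : ℕ) : WithTop ℕ∞) g) (r : Fin p) :
    partialDeriv r (multiDeriv α g) = multiDeriv (α + Pi.single r 1) g :=
  partialDeriv_multiDerivOn (List.finRange p) (List.nodup_finRange p) (List.mem_finRange r)
    (by rwa [sum_map_finRange])

theorem multiDeriv_zero (g : (Fin p → ℝ) → ℝ) : multiDeriv 0 g = g := by
  have : ∀ L : List (Fin p), multiDerivOn L 0 g = g := by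
    intro L
    induction L with
    | nil => rfl
    | cons q L ih => exact ih
  exact this _

theorem hasDerivAt_comp_line {g : (Fin p → ℝ) → ℝ} (hg : Differentiable ℝ g)
    (x w : Fin p → ℝ) (s : ℝ) :
    HasDerivAt (fun s : ℝ => g (x + s • w)) (∑ r, w r * partialDeriv r g (x + s • w)) s := by
  have h1 : HasDerivAt (fun s : ℝ => x + s • w) w s := by
    simpa using ((hasDerivAt_id s).smul_const w).const_add x
  have h2 := (hg (x + s • w)).hasFDerivAt.comp_hasDerivAt s h1
  refine h2.congr_deriv ?_
  simp only [partialDeriv_eq_fderiv hg]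
  generalize x + s • w = y
  conv_lhs => rw [pi_eq_sum_univ' w]
  simp

end Derivatives

/-- `T k s` plays the part of the `k`-th Taylor term, divided by `k!`, at the moving base point `s`.
The derivatives of consecutive summands telescope, and only the top one survives. -/
theorem hasDerivAt_taylor_sum {T : ℕ → ℝ → ℝ} {N : ℕ}
    (hT : ∀ k < N, ∀ s, HasDerivAt (T k) ((k + 1) * T (k + 1) s) s) (s : ℝ) :
    HasDerivAt (fun s => ∑ k ∈ range N, (1 - s) ^ k * T k s) (N * (1 - s) ^ (N - 1) * T N s) s := by
  have h : ∀ k ∈ range N, HasDerivAt (fun s => (1 - s) ^ k * T k s)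
      ((((k + 1 : ℕ) : ℝ) * (1 - s) ^ (k + 1 - 1) * T (k + 1) s) -
        (k : ℝ) * (1 - s) ^ (k - 1) * T k s) s := by
    intro k hk
    have h1 : HasDerivAt (fun s : ℝ => 1 - s) (-1) s := by
      simpa using (hasDerivAt_id s).const_sub 1
    refine ((h1.fun_pow k).fun_mul (hT k (mem_range.1 hk) s)).congr_deriv ?_
    simp only [Nat.add_sub_cancel]
    push_cast
    ring
  refine (HasDerivAt.fun_sum h).congr_deriv ?_
  rw [sum_range_sub (fun k : ℕ => (k : ℝ) * (1 - s) ^ (k - 1) * T k s)]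
  simp

theorem taylor_of_hasDerivAt {T : ℕ → ℝ → ℝ} {N : ℕ} (hN : 1 ≤ N)
    (hT : ∀ k < N, ∀ s, HasDerivAt (T k) ((k + 1) * T (k + 1) s) s) (hc : Continuous (T N)) :
    T 0 1 = ∑ k ∈ range N, T k 0 + N * ∫ s in (0 : ℝ)..1, (1 - s) ^ (N - 1) * T N s := by
  have h := intervalIntegral.integral_eq_sub_of_hasDerivAt (a := 0) (b := 1)
    (fun s _ => hasDerivAt_taylor_sum hT s)
    (Continuous.intervalIntegrable (by fun_prop) _ _)
  have e1 : ∑ k ∈ range N, (1 - (1 : ℝ)) ^ k * T k 1 = T 0 1 := by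
    rw [sum_eq_single 0] <;> simp +contextual; omega
  have e2 : ∑ k ∈ range N, (1 - (0 : ℝ)) ^ k * T k 0 = ∑ k ∈ range N, T k 0 := by simp
  rw [e1, e2] at h
  simp only [mul_assoc, intervalIntegral.integral_const_mul] at h
  linarith

section Taylor

variable {p : ℕ}

theorem prod_pow_add_single (w : Fin p → ℝ) (α : Fin p → ℕ) (r : Fin p) :
    ∏ q, w q ^ (α + Pi.single r 1 : Fin p → ℕ) q = (∏ q, w q ^ α q) * w r := by
  simp only [Pi.add_apply, pow_add, prod_mul_distrib]
  congr 1
  rw [prod_eq_single r]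
  · simp
  · intro q _ hq; simp [hq]
  · simp

theorem prod_factorial_add_single (α : Fin p → ℕ) (r : Fin p) :
    ∏ q, (((α + Pi.single r 1 : Fin p → ℕ) q).factorial : ℝ) =
      (∏ q, ((α q).factorial : ℝ)) * ((α r : ℝ) + 1) := by
  rw [← mul_prod_erase univ _ (mem_univ r), ← mul_prod_erase univ (fun q => ((α q).factorial : ℝ))
    (mem_univ r)]
  have h : ∏ q ∈ univ.erase r, (((α + Pi.single r 1 : Fin p → ℕ) q).factorial : ℝ) =
      ∏ q ∈ univ.erase r, ((α q).factorial : ℝ) :=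
    prod_congr rfl fun q hq => by simp [ne_of_mem_erase hq]
  rw [h, Pi.add_apply, Pi.single_eq_same, Nat.factorial_succ]
  push_cast
  ring

/-- For `β = α + e_r` one has `w_r w^α/α! = β_r w^β/β!`; summing over `r` gives `|β| = k + 1`. This
makes the Taylor terms satisfy the recursion of `hasDerivAt_taylor_sum`. -/
theorem sum_multiIndices_succ (k : ℕ) (w : Fin p → ℝ) (H : (Fin p → ℕ) → ℝ) :
    ∑ α ∈ multiIndices p k, (∏ q, w q ^ α q) / (∏ q, ((α q).factorial : ℝ)) *
      ∑ r, w r * H (α + Pi.single r 1) =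
    (k + 1) * ∑ β ∈ multiIndices p (k + 1),
      (∏ q, w q ^ β q) / (∏ q, ((β q).factorial : ℝ)) * H β := by
  have h1 : ∀ r : Fin p, ∑ α ∈ multiIndices p k, (∏ q, w q ^ α q) / (∏ q, ((α q).factorial : ℝ)) *
      (w r * H (α + Pi.single r 1)) = ∑ β ∈ multiIndices p (k + 1),
        (β r : ℝ) * ((∏ q, w q ^ β q) / (∏ q, ((β q).factorial : ℝ)) * H β) := by
    intro r
    rw [← sum_filter_add_sum_filter_not (multiIndices p (k + 1)) (fun β => β r = 0)]
    rw [sum_eq_zero (s := (multiIndices p (k + 1)).filter (fun β => β r = 0)), zero_add]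
    · refine sum_bij' (fun α _ => α + Pi.single r 1) (fun β _ => β - Pi.single r 1) ?_ ?_ ?_ ?_ ?_
      · intro α hα
        rw [mem_filter, mem_multiIndices]
        rw [mem_multiIndices] at hα
        simp [sum_add_distrib, hα]
      · intro β hβ
        rw [mem_filter, mem_multiIndices] at hβ
        rw [mem_multiIndices]
        have : β = (β - Pi.single r 1) + Pi.single r 1 := by
          ext q
          by_cases hq : q = r
          · subst hq; simp; omega
          · simp [hq]
        have h2 := hβ.1
        rw [this] at h2
        simpa [sum_add_distrib] using h2
      · intro α _; ext q; simp
      · intro β hβ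
        rw [mem_filter] at hβ
        ext q
        by_cases hq : q = r
        · subst hq; simp; omega
        · simp [hq]
      · intro α _
        rw [prod_pow_add_single, prod_factorial_add_single]
        have : (0 : ℝ) < ∏ q, ((α q).factorial : ℝ) := prod_pos fun q _ => by positivity
        simp only [Pi.add_apply, Pi.single_eq_same]
        push_cast
        field_simp
    · intro β hβ
      simp [(mem_filter.1 hβ).2]
  simp only [mul_sum]
  rw [sum_comm, sum_congr rfl fun r _ => h1 r, sum_comm]
  refine sum_congr rfl fun β hβ => ?_
  rw [← sum_mul]
  rw [mem_multiIndices] at hβ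
  congr 1
  exact_mod_cast hβ

theorem taylor_multiDeriv {f : (Fin p → ℝ) → ℝ} {N : ℕ} (hN : 1 ≤ N)
    (hf : ContDiff ℝ (N : WithTop ℕ∞) f) (x w : Fin p → ℝ) :
    f (x + w) = ∑ k ∈ range N, ∑ α ∈ multiIndices p k,
        (∏ q, w q ^ α q) / (∏ q, ((α q).factorial : ℝ)) * multiDeriv α f x +
      N * ∫ s in (0 : ℝ)..1, (1 - s) ^ (N - 1) * ∑ α ∈ multiIndices p N,
        (∏ q, w q ^ α q) / (∏ q, ((α q).factorial : ℝ)) * multiDeriv α f (x + s • w) := by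
  have h := taylor_of_hasDerivAt (T := fun k s => ∑ α ∈ multiIndices p k,
    (∏ q, w q ^ α q) / (∏ q, ((α q).factorial : ℝ)) * multiDeriv α f (x + s • w)) hN ?_ ?_
  · simp only [zero_smul, add_zero, one_smul] at h
    rw [← h]
    have : multiIndices p 0 = {0} := by
      ext α; rw [mem_multiIndices]; simp [funext_iff]
    simp [this, multiDeriv_zero]
  · intro k hk s
    have hd : ∀ α ∈ multiIndices p k, HasDerivAt (fun s : ℝ =>
        (∏ q, w q ^ α q) / (∏ q, ((α q).factorial : ℝ)) * multiDeriv α f (x + s • w))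
        ((∏ q, w q ^ α q) / (∏ q, ((α q).factorial : ℝ)) *
          ∑ r, w r * multiDeriv (α + Pi.single r 1) f (x + s • w)) s := by
      intro α hα
      rw [mem_multiIndices] at hα
      have hf' : ContDiff ℝ ((∑ r, α r + 1 : ℕ) : WithTop ℕ∞) f :=
        hf.of_le (by norm_cast; omega)
      have h1 : Differentiable ℝ (multiDeriv α f) :=
        (contDiff_multiDeriv (n := 1) (by rwa [add_comm 1])).differentiable (by simp)
      have h2 := hasDerivAt_comp_line h1 x w s
      simp only [partialDeriv_multiDeriv hf'] at h2
      exact h2.const_mul _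
    have := HasDerivAt.fun_sum hd
    rwa [sum_multiIndices_succ k w (fun α => multiDeriv α f (x + s • w))] at this
  · refine continuous_finsetSum _ fun α hα => ?_
    have := continuous_multiDeriv hf (mem_multiIndices.1 hα)
    fun_prop

end Taylor

end AltSum

/-! ### Corner differences of an antiderivative as integrals over a cube. -/

namespace AltSum

open Finset MeasureTheory

section Difference

variable {p : ℕ}

/-- The difference of the values at `1` and at `-1` of the `r`-th coordinate. -/
noncomputable def diffOp (r : Fin p) (φ : (Fin p → ℝ) → ℝ) : (Fin p → ℝ) → ℝ :=
  fun x => φ (Function.update x r 1) - φ (Function.update x r (-1))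

/-- The integral over `[-1, 1]` in the `r`-th coordinate. -/
noncomputable def intOp (r : Fin p) (φ : (Fin p → ℝ) → ℝ) : (Fin p → ℝ) → ℝ :=
  fun x => ∫ t in (-1 : ℝ)..1, φ (Function.update x r t)

/-- `f` is the iterated partial derivative of `F` along the coordinates in a list. -/
def IsIteratedDeriv : List (Fin p) → ((Fin p → ℝ) → ℝ) → ((Fin p → ℝ) → ℝ) → Prop
  | [], F, f => F = f
  | r :: L, F, f => ∃ F' : (Fin p → ℝ) → ℝ,
      (∀ x, HasLineDerivAt ℝ F (F' x) x (Pi.single r 1)) ∧ IsIteratedDeriv L F' f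

theorem isIteratedDeriv_ofFn {n : ℕ} (σ : Fin n → Fin p) (G : Fin (n + 1) → (Fin p → ℝ) → ℝ)
    (h : ∀ (r : Fin n) (x : Fin p → ℝ),
      HasLineDerivAt ℝ (G r.castSucc) (G r.succ x) x (Pi.single (σ r) 1)) :
    IsIteratedDeriv (List.ofFn σ) (G 0) (G (Fin.last n)) := by
  induction n with
  | zero => rfl
  | succ n ih =>
    rw [List.ofFn_succ]
    refine ⟨G 1, fun x => h 0 x, ?_⟩
    exact ih (fun i => σ i.succ) (fun i => G i.succ) (fun r x => h r.succ x)

theorem IsAntiderivative.exists_list {F f : (Fin p → ℝ) → ℝ} (h : IsAntiderivative F f) :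
    ∃ L : List (Fin p), L.Nodup ∧ (∀ r, r ∈ L) ∧ IsIteratedDeriv L F f := by
  obtain ⟨σ, G, rfl, rfl, hG⟩ := h
  exact ⟨List.ofFn σ, List.nodup_ofFn.2 σ.injective,
    fun r => (List.mem_ofFn' _ _).2 (σ.surjective r), isIteratedDeriv_ofFn σ G hG⟩

theorem update_add_smul_single_of_ne {q r : Fin p} (h : q ≠ r) (x : Fin p → ℝ) (t a : ℝ) :
    Function.update (x + t • (Pi.single q 1 : Fin p → ℝ)) r a =
      Function.update x r a + t • (Pi.single q 1 : Fin p → ℝ) := by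
  ext s
  by_cases hs : s = r
  · subst hs; simp [Ne.symm h]
  · simp [hs]

theorem hasLineDerivAt_diffOp {F F' : (Fin p → ℝ) → ℝ} {q r : Fin p} (hqr : q ≠ r)
    (h : ∀ x, HasLineDerivAt ℝ F (F' x) x (Pi.single q 1)) (x : Fin p → ℝ) :
    HasLineDerivAt ℝ (diffOp r F) (diffOp r F' x) x (Pi.single q 1) := by
  unfold HasLineDerivAt diffOp
  simp only [update_add_smul_single_of_ne hqr]
  exact (h (Function.update x r 1)).fun_sub (h (Function.update x r (-1)))

theorem hasLineDerivAt_foldr_diffOp {q : Fin p} (L : List (Fin p)) (hq : q ∉ L)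
    {F F' : (Fin p → ℝ) → ℝ} (h : ∀ x, HasLineDerivAt ℝ F (F' x) x (Pi.single q 1)) :
    ∀ x, HasLineDerivAt ℝ (L.foldr diffOp F) (L.foldr diffOp F' x) x (Pi.single q 1) := by
  induction L with
  | nil => exact h
  | cons r L ih =>
    rw [List.mem_cons, not_or] at hq
    exact hasLineDerivAt_diffOp hq.1 (ih hq.2)

theorem continuous_intOp {φ : (Fin p → ℝ) → ℝ} (h : Continuous φ) (r : Fin p) :
    Continuous (intOp r φ) := by
  refine intervalIntegral.continuous_parametric_intervalIntegral_of_continuous' ?_ _ _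
  exact h.comp (continuous_fst.update r continuous_snd)

theorem continuous_foldr_intOp {φ : (Fin p → ℝ) → ℝ} (h : Continuous φ) (L : List (Fin p)) :
    Continuous (L.foldr intOp φ) := by
  induction L with
  | nil => exact h
  | cons r L ih => exact continuous_intOp ih r

theorem diffOp_eq_intOp {F F' : (Fin p → ℝ) → ℝ} {r : Fin p} (hF' : Continuous F')
    (h : ∀ x, HasLineDerivAt ℝ F (F' x) x (Pi.single r 1)) : diffOp r F = intOp r F' := by
  ext x
  have hd : ∀ t : ℝ, HasDerivAt (fun t => F (Function.update x r t))
      (F' (Function.update x r t)) t := by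
    intro t
    have h1 := h (Function.update x r t)
    unfold HasLineDerivAt at h1
    rw [← sub_self t] at h1
    have h2 := h1.comp_sub_const t t
    refine h2.congr_of_eventuallyEq (Filter.Eventually.of_forall fun s => ?_)
    have e : Function.update x r s =
        Function.update x r t + (s - t) • (Pi.single r 1 : Fin p → ℝ) := by
      ext q
      by_cases hq : q = r
      · subst hq; simp
      · simp [hq]
    exact congrArg F e
  refine (intervalIntegral.integral_eq_sub_of_hasDerivAt (fun t _ => hd t) ?_).symm
  refine Continuous.intervalIntegrable ?_ _ _
  exact hF'.comp (continuous_const.update r continuous_id)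

/-- The intermediate derivatives of `F` need not be continuous, so the fundamental theorem cannot be
applied to them directly. Differencing in the remaining coordinates first commutes with `∂_r` and,
by induction, turns the derivative into an iterated integral of `f`, which is continuous. -/
theorem foldr_diffOp_eq_foldr_intOp (L : List (Fin p)) (hL : L.Nodup)
    {F f : (Fin p → ℝ) → ℝ} (hf : Continuous f) (h : IsIteratedDeriv L F f) :
    L.foldr diffOp F = L.foldr intOp f := by
  induction L generalizing F with
  | nil => exact h
  | cons r L ih =>
    obtain ⟨F', hF', hL'⟩ := h
    rw [List.nodup_cons] at hL
    have h1 := hasLineDerivAt_foldr_diffOp L hL.1 hF'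
    rw [ih hL.2 hL'] at h1
    exact diffOp_eq_intOp (continuous_foldr_intOp hf L) h1

theorem foldr_diffOp_apply (L : List (Fin p)) (hL : L.Nodup) (F : (Fin p → ℝ) → ℝ)
    (x : Fin p → ℝ) :
    L.foldr diffOp F x = ∑ J ∈ L.toFinset.powerset, (-1 : ℝ) ^ (L.length - J.card) *
      F (fun r => if r ∈ L then (if r ∈ J then 1 else -1) else x r) := by
  induction L generalizing x with
  | nil => simp
  | cons q L ih =>
    rw [List.nodup_cons] at hL
    change L.foldr diffOp F (Function.update x q 1) - L.foldr diffOp F (Function.update x q (-1)) = _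
    have hq : q ∉ L.toFinset := by simpa using hL.1
    rw [ih hL.2, ih hL.2, List.toFinset_cons, sum_powerset_insert hq, add_comm, sub_eq_add_neg,
      ← sum_neg_distrib]
    congr 1
    · refine sum_congr rfl fun J hJ => ?_
      have hqJ : q ∉ J := fun h => hq (mem_powerset.1 hJ h)
      rw [card_insert_of_notMem hqJ, List.length_cons, Nat.add_sub_add_right]
      congr 2
      ext r
      by_cases hr : r = q
      · subst hr; simp [hL.1]
      · simp [hr]
    · refine sum_congr rfl fun J hJ => ?_
      have hqJ : q ∉ J := fun h => hq (mem_powerset.1 hJ h)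
      have hc : J.card ≤ L.length :=
        (card_le_card (mem_powerset.1 hJ)).trans (List.toFinset_card_le L)
      rw [List.length_cons, Nat.succ_sub hc, pow_succ, mul_neg_one, neg_mul]
      congr 3
      ext r
      by_cases hr : r = q
      · subst hr; simp [hL.1, hqJ]
      · simp [hr]

end Difference

section Measure

variable {p : ℕ}

theorem volume_restrict_Icc_eq_pi :
    (volume : Measure (Fin p → ℝ)).restrict (Set.Icc (-1) 1) =
      Measure.pi fun _ : Fin p => (volume : Measure ℝ).restrict (Set.Icc (-1) 1) := by
  rw [← Set.pi_univ_Icc, volume_pi, Measure.restrict_pi_pi]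
  rfl

theorem map_update_prod_pi (ν : Measure ℝ) [IsFiniteMeasure ν] (hν : ν Set.univ ≠ 0)
    (r : Fin p) :
    ((Measure.pi fun _ : Fin p => ν).prod ν).map (fun q => Function.update q.1 r q.2) =
      ν Set.univ • Measure.pi fun _ : Fin p => ν := by
  have hmeas : Measurable fun q : (Fin p → ℝ) × ℝ => Function.update q.1 r q.2 :=
    (continuous_fst.update r continuous_snd).measurable
  have hfin : ν Set.univ ≠ ⊤ := measure_ne_top _ _
  suffices h : (Measure.pi fun _ : Fin p => ν) = (ν Set.univ)⁻¹ •
      ((Measure.pi fun _ : Fin p => ν).prod ν).map (fun q => Function.update q.1 r q.2) by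
    conv_rhs => rw [h]
    rw [smul_smul, ENNReal.mul_inv_cancel hν hfin, one_smul]
  -- A product measure is determined on boxes; the overwritten coordinate only contributes the total
  -- mass.
  refine Measure.pi_eq fun s hs => ?_
  have hpre : (fun q : (Fin p → ℝ) × ℝ => Function.update q.1 r q.2) ⁻¹' (Set.univ.pi s) =
      (Set.univ.pi (Function.update s r Set.univ)) ×ˢ s r := by
    ext ⟨x, t⟩
    simp only [Set.mem_preimage, Set.mem_pi, Set.mem_univ, true_imp_iff, Set.mem_prod]
    constructor
    · intro h
      refine ⟨fun q => ?_, by simpa using h r⟩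
      by_cases hq : q = r
      · subst hq; simp
      · simpa [hq] using h q
    · rintro ⟨h1, h2⟩ q
      by_cases hq : q = r
      · subst hq; simpa using h2
      · simpa [hq] using h1 q
  rw [Measure.smul_apply, Measure.map_apply hmeas (MeasurableSet.univ_pi hs), hpre,
    Measure.prod_prod, Measure.pi_pi, smul_eq_mul, ← mul_prod_erase univ _ (mem_univ r),
    ← mul_prod_erase univ (fun i => ν (s i)) (mem_univ r), Function.update_self]
  have : ∏ q ∈ univ.erase r, ν (Function.update s r Set.univ q) = ∏ q ∈ univ.erase r, ν (s q) :=
    prod_congr rfl fun q hq => by rw [Function.update_of_ne (ne_of_mem_erase hq)]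
  rw [this, mul_assoc, ← mul_assoc, ENNReal.inv_mul_cancel hν hfin, one_mul, mul_comm]

theorem integral_intOp {φ : (Fin p → ℝ) → ℝ} (h : Continuous φ) (r : Fin p) :
    ∫ x in Set.Icc (-1 : Fin p → ℝ) 1, intOp r φ x =
      2 * ∫ x in Set.Icc (-1 : Fin p → ℝ) 1, φ x := by
  set ν : Measure ℝ := (volume : Measure ℝ).restrict (Set.Icc (-1) 1) with hν
  have hmass : ν Set.univ = 2 := by
    rw [hν, Measure.restrict_apply_univ, Real.volume_Icc]; norm_num
  have hmap := map_update_prod_pi (p := p) ν (by rw [hmass]; norm_num) r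
  have hint : Integrable φ (Measure.pi fun _ : Fin p => ν) := by
    rw [hν, ← volume_restrict_Icc_eq_pi]
    exact h.continuousOn.integrableOn_compact isCompact_Icc
  have hcont : Continuous fun q : (Fin p → ℝ) × ℝ => Function.update q.1 r q.2 :=
    continuous_fst.update r continuous_snd
  have hint2 : Integrable (fun q : (Fin p → ℝ) × ℝ => φ (Function.update q.1 r q.2))
      ((Measure.pi fun _ : Fin p => ν).prod ν) := by
    have := hint.smul_measure (c := ν Set.univ) (by rw [hmass]; norm_num)
    rw [← hmap] at this
    exact (integrable_map_measure h.aestronglyMeasurable hcont.measurable.aemeasurable).1 this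
  have key : ∫ q, φ (Function.update q.1 r q.2) ∂((Measure.pi fun _ : Fin p => ν).prod ν) =
      2 * ∫ x, φ x ∂(Measure.pi fun _ : Fin p => ν) := by
    rw [← integral_map (φ := fun q : (Fin p → ℝ) × ℝ => Function.update q.1 r q.2) (f := φ)
      hcont.measurable.aemeasurable h.aestronglyMeasurable, hmap, integral_smul_measure, hmass]
    simp
  rw [volume_restrict_Icc_eq_pi, ← hν, ← key, integral_prod _ hint2]
  refine integral_congr_ae (Filter.Eventually.of_forall fun x => ?_)
  simp only [intOp]
  rw [intervalIntegral.integral_of_le (by norm_num), hν, integral_Icc_eq_integral_Ioc]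

theorem integral_foldr_intOp {φ : (Fin p → ℝ) → ℝ} (h : Continuous φ) (L : List (Fin p)) :
    ∫ x in Set.Icc (-1 : Fin p → ℝ) 1, L.foldr intOp φ x =
      2 ^ L.length * ∫ x in Set.Icc (-1 : Fin p → ℝ) 1, φ x := by
  induction L with
  | nil => simp
  | cons r L ih =>
    rw [List.foldr_cons, integral_intOp (continuous_foldr_intOp h L), ih, List.length_cons]
    ring

theorem length_eq_of_forall_mem {L : List (Fin p)} (hL : L.Nodup) (hall : ∀ r, r ∈ L) :
    L.length = p := by
  rw [← List.toFinset_card_of_nodup hL, show L.toFinset = univ by ext; simp [hall]]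
  simp

/-- The integral of a mixed partial derivative over the cube `[-1, 1]^p`. -/
theorem integral_cube_eq_sum {F f : (Fin p → ℝ) → ℝ} (hf : Continuous f) {L : List (Fin p)}
    (hL : L.Nodup) (hall : ∀ r, r ∈ L) (h : IsIteratedDeriv L F f) :
    ∫ x in Set.Icc (-1 : Fin p → ℝ) 1, f x =
      ∑ J : Finset (Fin p), (-1 : ℝ) ^ (p - J.card) * F (fun r => if r ∈ J then 1 else -1) := by
  -- Differencing in all coordinates yields a constant function. Averaging it over the cube compares
  -- it with `∫ f` directly, without converting the iterated integral in the order `L` into a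
  -- multiple integral.
  have h1 := integral_foldr_intOp hf L
  have hlen := length_eq_of_forall_mem hL hall
  rw [← foldr_diffOp_eq_foldr_intOp L hL hf h] at h1
  simp only [foldr_diffOp_apply L hL, hall, if_true, hlen] at h1
  rw [show L.toFinset = univ by ext; simp [hall], powerset_univ, setIntegral_const] at h1
  have hvol : volume.real (Set.Icc (-1 : Fin p → ℝ) 1) = 2 ^ p := by
    rw [Measure.real, Real.volume_Icc_pi_toReal (by intro r; simp)]
    norm_num
  rw [hvol, smul_eq_mul] at h1
  exact (mul_left_cancel₀ (by positivity) h1).symm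

theorem IsIteratedDeriv.comp_mul {L : List (Fin p)} {F f : (Fin p → ℝ) → ℝ}
    (h : IsIteratedDeriv L F f) (a : Fin p → ℝ) (c : ℝ) :
    IsIteratedDeriv L (fun v => c * F (a * v)) (fun v => c * (L.map a).prod * f (a * v)) := by
  induction L generalizing F c with
  | nil =>
    obtain rfl : F = f := h
    simp [IsIteratedDeriv]
  | cons r L ih =>
    obtain ⟨F', hF', hL⟩ := h
    refine ⟨fun v => c * a r * F' (a * v), fun x => ?_, ?_⟩
    · have h1 := hF' (a * x)
      unfold HasLineDerivAt at h1 ⊢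
      have h2 : HasDerivAt (fun t : ℝ => t * a r) (a r) 0 := by
        simpa using (hasDerivAt_id (0 : ℝ)).mul_const (a r)
      rw [show (0 : ℝ) = 0 * a r by ring] at h1
      have h3 := (h1.comp (0 : ℝ) h2).const_mul c
      refine (h3.congr_deriv (by ring)).congr_of_eventuallyEq
        (Filter.Eventually.of_forall fun t => ?_)
      simp only [Function.comp]
      congr 2
      ext q
      by_cases hq : q = r
      · subst hq; simp; ring
      · simp [hq]
    · have := ih hL (c * a r)
      simpa [mul_assoc] using this

theorem IsIteratedDeriv.shiftedSum {L : List (Fin p)} {F f : (Fin p → ℝ) → ℝ}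
    (h : IsIteratedDeriv L F f) (n : Fin p → ℕ) :
    IsIteratedDeriv L (shiftedSum F n) (shiftedSum f n) := by
  induction L generalizing F with
  | nil =>
    obtain rfl : F = f := h
    simp [IsIteratedDeriv]
  | cons r L ih =>
    obtain ⟨F', hF', hL⟩ := h
    refine ⟨AltSum.shiftedSum F' n, fun x => ?_, ih hL⟩
    unfold HasLineDerivAt AltSum.shiftedSum
    refine HasDerivAt.fun_sum fun k _ => ?_
    have h1 := hF' (fun r => (k r : ℝ) + x r)
    unfold HasLineDerivAt at h1
    refine h1.congr_of_eventuallyEq (Filter.Eventually.of_forall fun t => ?_)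
    simp only
    congr 1
    ext q
    simp [add_assoc]

end Measure

end AltSum

/-! ### Shifted sums, and the summation formula with integral remainder. -/

namespace AltSum

open Finset MeasureTheory

section ShiftedSum

variable {p : ℕ}

theorem contDiff_shiftedSum {g : (Fin p → ℝ) → ℝ} {N : WithTop ℕ∞} (hg : ContDiff ℝ N g)
    (n : Fin p → ℕ) : ContDiff ℝ N (shiftedSum g n) := by
  unfold shiftedSum
  refine ContDiff.sum fun k _ => hg.comp ?_
  exact contDiff_const.add contDiff_id

theorem partialDeriv_shiftedSum {g : (Fin p → ℝ) → ℝ} (hg : Differentiable ℝ g)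
    (n : Fin p → ℕ) (r : Fin p) :
    partialDeriv r (shiftedSum g n) = shiftedSum (partialDeriv r g) n := by
  ext x
  refine HasLineDerivAt.lineDeriv ?_
  unfold HasLineDerivAt shiftedSum
  refine HasDerivAt.fun_sum fun k _ => ?_
  have h1 := ((hg (fun r => (k r : ℝ) + x r)).lineDifferentiableAt
    (v := Pi.single r 1)).hasLineDerivAt
  unfold HasLineDerivAt at h1
  refine h1.congr_of_eventuallyEq (Filter.Eventually.of_forall fun t => congrArg g ?_)
  ext q
  simp [add_assoc]

theorem iterate_partialDeriv_shiftedSum {g : (Fin p → ℝ) → ℝ} {a : ℕ}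
    (hg : ContDiff ℝ (a : WithTop ℕ∞) g) (n : Fin p → ℕ) (r : Fin p) :
    (partialDeriv r)^[a] (shiftedSum g n) = shiftedSum ((partialDeriv r)^[a] g) n := by
  induction a with
  | zero => rfl
  | succ a ih =>
    rw [Function.iterate_succ_apply', Function.iterate_succ_apply',
      ih (hg.of_le (by norm_cast; omega)), partialDeriv_shiftedSum]
    refine (contDiff_iterate_partialDeriv (n := 1) ?_ r).differentiable (by simp)
    rwa [add_comm 1]

theorem multiDeriv_shiftedSum {g : (Fin p → ℝ) → ℝ} {α : Fin p → ℕ} {N : ℕ}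
    (hg : ContDiff ℝ (N : WithTop ℕ∞) g) (hα : ∑ r, α r = N) (n : Fin p → ℕ) :
    multiDeriv α (shiftedSum g n) = shiftedSum (multiDeriv α g) n := by
  have key : ∀ L : List (Fin p), ContDiff ℝ (((L.map α).sum : ℕ) : WithTop ℕ∞) g →
      multiDerivOn L α (shiftedSum g n) = shiftedSum (multiDerivOn L α g) n := by
    intro L
    induction L with
    | nil => exact fun _ => rfl
    | cons q L ih =>
      intro h
      rw [List.map_cons, List.sum_cons] at h
      change (partialDeriv q)^[α q] (multiDerivOn L α (shiftedSum g n)) =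
        shiftedSum ((partialDeriv q)^[α q] (multiDerivOn L α g)) n
      rw [ih (h.of_le (by norm_cast; omega)), iterate_partialDeriv_shiftedSum]
      exact contDiff_multiDerivOn L h
  exact key _ (by rwa [sum_map_finRange, hα])

theorem continuous_shiftedSum {g : (Fin p → ℝ) → ℝ} (hg : Continuous g) (n : Fin p → ℕ) :
    Continuous (shiftedSum g n) := by
  unfold shiftedSum
  fun_prop

end ShiftedSum

section Remainder

variable {p : ℕ}

/-- The remainder built from an arbitrary family of functions in place of the series of the
partial derivatives. -/
noncomputable def remainderOf (m : ℕ) (Φ : (Fin p → ℕ) → (Fin p → ℝ) → ℝ) : ℝ :=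
  (m : ℝ) / 2 ^ (2 * m + p - 1) *
    ∑ α ∈ multiIndices p (2 * m), 1 / (∏ r, ((α r).factorial : ℝ)) *
      ∫ s in (0 : ℝ)..1, (1 - s) ^ (2 * m - 1) *
        ∫ v in Set.Icc (-1 : Fin p → ℝ) 1, (∏ r, v r ^ α r) *
          ∑ j ∈ Finset.Icc (1 : Fin p → ℕ) (fun _ => m),
            gammaCoeff m j * (∏ r, (j r : ℝ) ^ (α r + 1)) *
              Φ α (fun r => s * (j r : ℝ) * v r / 2)

theorem remainderInfty_eq (m : ℕ) (f : (Fin p → ℝ) → ℝ) :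
    remainderInfty m f = remainderOf m (fun α => shiftedSeries (multiDeriv α f)) := rfl

theorem integral_cube_swap {K : ℝ → (Fin p → ℝ) → ℝ} (hK : Continuous (Function.uncurry K)) :
    ∫ v in Set.Icc (-1 : Fin p → ℝ) 1, ∫ s in (0 : ℝ)..1, K s v =
      ∫ s in (0 : ℝ)..1, ∫ v in Set.Icc (-1 : Fin p → ℝ) 1, K s v := by
  simp only [intervalIntegral.integral_of_le zero_le_one]
  simp only [← integral_Icc_eq_integral_Ioc]
  refine (integral_integral_swap (f := K) ?_).symm
  rw [Measure.prod_restrict]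
  exact hK.continuousOn.integrableOn_compact (isCompact_Icc.prod isCompact_Icc)

theorem integral_cube_prod_pow (α : Fin p → ℕ) :
    ∫ v in Set.Icc (-1 : Fin p → ℝ) 1, ∏ r, v r ^ α r =
      ∏ r, (1 ^ (α r + 1) - (-1) ^ (α r + 1)) / ((α r : ℝ) + 1) := by
  rw [volume_restrict_Icc_eq_pi, integral_fintype_prod_eq_prod (fun r (t : ℝ) => t ^ α r)]
  refine prod_congr rfl fun r _ => ?_
  rw [integral_Icc_eq_integral_Ioc, ← intervalIntegral.integral_of_le (by norm_num), integral_pow]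

/-- Everything factors over the coordinates, and a total degree below `2m` keeps every `α_r` in the
range where the one-dimensional moments are known. -/
theorem sum_gammaCoeff_moment {m k : ℕ} (hk : k < 2 * m) {α : Fin p → ℕ}
    (hα : α ∈ multiIndices p k) :
    ∑ j ∈ Icc (1 : Fin p → ℕ) (fun _ => m), gammaCoeff m j * ((∏ r, ((j r : ℝ) / 2)) *
      ∫ v in Set.Icc (-1 : Fin p → ℝ) 1, ∏ r, ((j r : ℝ) / 2 * v r) ^ α r) =
      if α = 0 then 1 else 0 := by
  have h1 : ∀ j : Fin p → ℕ, gammaCoeff m j * ((∏ r, ((j r : ℝ) / 2)) *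
      ∫ v in Set.Icc (-1 : Fin p → ℝ) 1, ∏ r, ((j r : ℝ) / 2 * v r) ^ α r) =
      ∏ r, gamma1 m (j r) * (((j r : ℝ) / 2) ^ (α r + 1) - (-((j r : ℝ) / 2)) ^ (α r + 1)) /
        ((α r : ℝ) + 1) := by
    intro j
    simp only [mul_pow, prod_mul_distrib, integral_const_mul]
    rw [integral_cube_prod_pow, gammaCoeff, ← prod_mul_distrib, ← prod_mul_distrib,
      ← prod_mul_distrib]
    refine prod_congr rfl fun r _ => ?_
    rw [neg_pow ((j r : ℝ) / 2)]
    ring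
  simp only [h1]
  rw [Icc_eq_piFinset]
  simp only [Pi.one_apply]
  rw [← prod_univ_sum (t := fun _ : Fin p => Icc 1 m) (f := fun r j =>
    gamma1 m j * (((j : ℝ) / 2) ^ (α r + 1) - (-((j : ℝ) / 2)) ^ (α r + 1)) / ((α r : ℝ) + 1))]
  have h2 : ∀ r, ∑ j ∈ Icc 1 m, gamma1 m j *
      (((j : ℝ) / 2) ^ (α r + 1) - (-((j : ℝ) / 2)) ^ (α r + 1)) / ((α r : ℝ) + 1) =
      if α r = 0 then 1 else 0 := by
    intro r
    have hr : α r ≤ k := by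
      rw [← mem_multiIndices.1 hα]; exact single_le_sum (fun _ _ => Nat.zero_le _) (mem_univ r)
    rw [← sum_div, sum_gamma1_mul_pow_sub (by omega)]
    by_cases h : α r = 0 <;> simp [h]
  simp only [h2]
  by_cases h : α = 0
  · simp [h]
  · obtain ⟨r, hr⟩ := Function.ne_iff.1 h
    rw [if_neg h]
    exact prod_eq_zero (mem_univ r) (if_neg hr)

/-- The integral of the Taylor polynomial against the coefficients. -/
theorem sum_gammaCoeff_taylor {m : ℕ} (hm : 1 ≤ m) (c : (Fin p → ℕ) → ℝ) :
    ∑ j ∈ Icc (1 : Fin p → ℕ) (fun _ => m), gammaCoeff m j * ((∏ r, ((j r : ℝ) / 2)) *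
      ∫ v in Set.Icc (-1 : Fin p → ℝ) 1, ∑ k ∈ range (2 * m), ∑ α ∈ multiIndices p k,
        (∏ q, ((j q : ℝ) / 2 * v q) ^ α q) / (∏ q, ((α q).factorial : ℝ)) * c α) = c 0 := by
  have hint : ∀ (j : Fin p → ℕ) (α : Fin p → ℕ), IntegrableOn (fun v : Fin p → ℝ =>
      (∏ q, ((j q : ℝ) / 2 * v q) ^ α q) / (∏ q, ((α q).factorial : ℝ)) * c α)
      (Set.Icc (-1) 1) := fun j α =>
    (Continuous.continuousOn (by fun_prop)).integrableOn_compact isCompact_Icc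
  have h1 : ∀ j : Fin p → ℕ, ∫ v in Set.Icc (-1 : Fin p → ℝ) 1, ∑ k ∈ range (2 * m),
      ∑ α ∈ multiIndices p k,
        (∏ q, ((j q : ℝ) / 2 * v q) ^ α q) / (∏ q, ((α q).factorial : ℝ)) * c α =
      ∑ k ∈ range (2 * m), ∑ α ∈ multiIndices p k,
        (c α / ∏ q, ((α q).factorial : ℝ)) *
          ∫ v in Set.Icc (-1 : Fin p → ℝ) 1, ∏ q, ((j q : ℝ) / 2 * v q) ^ α q := by
    intro j
    rw [integral_finsetSum _ fun k _ => integrable_finsetSum _ fun α _ => hint j α]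
    refine sum_congr rfl fun k _ => ?_
    rw [integral_finsetSum _ fun α _ => hint j α]
    refine sum_congr rfl fun α _ => ?_
    rw [← integral_const_mul]
    congr 1
    ext v
    ring
  simp only [h1, mul_sum]
  rw [sum_comm]
  have h2 : ∀ k ∈ range (2 * m), ∑ j ∈ Icc (1 : Fin p → ℕ) (fun _ => m),
      ∑ α ∈ multiIndices p k, gammaCoeff m j * ((∏ r, ((j r : ℝ) / 2)) *
        ((c α / ∏ q, ((α q).factorial : ℝ)) *
          ∫ v in Set.Icc (-1 : Fin p → ℝ) 1, ∏ q, ((j q : ℝ) / 2 * v q) ^ α q)) =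
      if k = 0 then c 0 else 0 := by
    intro k hk
    rw [sum_comm]
    have h3 : ∀ α ∈ multiIndices p k, ∑ j ∈ Icc (1 : Fin p → ℕ) (fun _ => m),
        gammaCoeff m j * ((∏ r, ((j r : ℝ) / 2)) * ((c α / ∏ q, ((α q).factorial : ℝ)) *
          ∫ v in Set.Icc (-1 : Fin p → ℝ) 1, ∏ q, ((j q : ℝ) / 2 * v q) ^ α q)) =
        if α = 0 then c 0 else 0 := by
      intro α hα
      have h4 := sum_gammaCoeff_moment (mem_range.1 hk) hα
      calc _ = (c α / ∏ q, ((α q).factorial : ℝ)) * if α = 0 then 1 else 0 := by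
            rw [← h4, mul_sum]
            exact sum_congr rfl fun j _ => by ring
        _ = _ := by
            by_cases h : α = 0
            · simp [h]
            · simp [h]
    rw [sum_congr rfl h3, sum_ite_eq']
    simp only [mem_multiIndices, Pi.zero_apply, sum_const_zero, eq_comm (a := 0)]
  rw [sum_congr rfl h2, sum_ite_eq', if_pos (mem_range.2 (by omega))]

/-- Fubini and regrouping turn the prescribed form into the one that Taylor's formula produces. The
prefactor `m/2^(2m+p-1)` is the Taylor factor `2m` times the `2^(-(2m+p))` from `∏ (j_r/2)^(α_r+1)`.
-/
theorem remainderOf_eq {m : ℕ} (hm : 1 ≤ m) (hp : 1 ≤ p) {Φ : (Fin p → ℕ) → (Fin p → ℝ) → ℝ}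
    (hΦ : ∀ α ∈ multiIndices p (2 * m), Continuous (Φ α)) :
    remainderOf m Φ = ∑ j ∈ Icc (1 : Fin p → ℕ) (fun _ => m), gammaCoeff m j *
      ((∏ r, ((j r : ℝ) / 2)) * ∫ v in Set.Icc (-1 : Fin p → ℝ) 1, ((2 * m : ℕ) : ℝ) *
        ∫ s in (0 : ℝ)..1, (1 - s) ^ (2 * m - 1) * ∑ α ∈ multiIndices p (2 * m),
          (∏ q, ((j q : ℝ) / 2 * v q) ^ α q) / (∏ q, ((α q).factorial : ℝ)) *
            Φ α (fun r => s * (j r : ℝ) * v r / 2)) := by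
  set I : (Fin p → ℕ) → (Fin p → ℕ) → ℝ := fun α j =>
    ∫ s in (0 : ℝ)..1, ∫ v in Set.Icc (-1 : Fin p → ℝ) 1,
      (1 - s) ^ (2 * m - 1) * (∏ r, v r ^ α r) * Φ α (fun r => s * (j r : ℝ) * v r / 2) with hI
  have hK : ∀ α ∈ multiIndices p (2 * m), ∀ j : Fin p → ℕ,
      Continuous (Function.uncurry fun (s : ℝ) (v : Fin p → ℝ) =>
        (1 - s) ^ (2 * m - 1) * (∏ r, v r ^ α r) * Φ α (fun r => s * (j r : ℝ) * v r / 2)) := by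
    intro α hα j
    have := hΦ α hα
    simp only [Function.uncurry_def]
    fun_prop
  have hKv : ∀ α ∈ multiIndices p (2 * m), ∀ j : Fin p → ℕ, ∀ s : ℝ,
      IntegrableOn (fun v : Fin p → ℝ =>
        (1 - s) ^ (2 * m - 1) * (∏ r, v r ^ α r) * Φ α (fun r => s * (j r : ℝ) * v r / 2))
        (Set.Icc (-1) 1) := by
    intro α hα j s
    have := hΦ α hα
    exact (Continuous.continuousOn (by fun_prop)).integrableOn_compact isCompact_Icc
  have hKs : ∀ α ∈ multiIndices p (2 * m), ∀ j : Fin p → ℕ, Continuous (fun s : ℝ =>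
      ∫ v in Set.Icc (-1 : Fin p → ℝ) 1,
        (1 - s) ^ (2 * m - 1) * (∏ r, v r ^ α r) * Φ α (fun r => s * (j r : ℝ) * v r / 2)) :=
    fun α hα j => continuous_parametric_integral_of_continuous (hK α hα j) isCompact_Icc
  have hKv' : ∀ α ∈ multiIndices p (2 * m), ∀ j : Fin p → ℕ, Continuous (fun v : Fin p → ℝ =>
      ∫ s in (0 : ℝ)..1,
        (1 - s) ^ (2 * m - 1) * (∏ r, v r ^ α r) * Φ α (fun r => s * (j r : ℝ) * v r / 2)) :=
    fun α hα j => intervalIntegral.continuous_parametric_intervalIntegral_of_continuous'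
      (f := fun (v : Fin p → ℝ) (s : ℝ) => (1 - s) ^ (2 * m - 1) * (∏ r, v r ^ α r) *
        Φ α (fun r => s * (j r : ℝ) * v r / 2)) ((hK α hα j).comp continuous_swap) _ _
  have hL : ∀ α ∈ multiIndices p (2 * m),
      ∫ s in (0 : ℝ)..1, (1 - s) ^ (2 * m - 1) *
        ∫ v in Set.Icc (-1 : Fin p → ℝ) 1, (∏ r, v r ^ α r) *
          ∑ j ∈ Finset.Icc (1 : Fin p → ℕ) (fun _ => m),
            gammaCoeff m j * (∏ r, (j r : ℝ) ^ (α r + 1)) *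
              Φ α (fun r => s * (j r : ℝ) * v r / 2) =
      ∑ j ∈ Icc (1 : Fin p → ℕ) (fun _ => m),
        gammaCoeff m j * (∏ r, (j r : ℝ) ^ (α r + 1)) * I α j := by
    intro α hα
    have e1 : ∀ s : ℝ, (1 - s) ^ (2 * m - 1) *
        ∫ v in Set.Icc (-1 : Fin p → ℝ) 1, (∏ r, v r ^ α r) *
          ∑ j ∈ Finset.Icc (1 : Fin p → ℕ) (fun _ => m),
            gammaCoeff m j * (∏ r, (j r : ℝ) ^ (α r + 1)) *
              Φ α (fun r => s * (j r : ℝ) * v r / 2) =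
        ∑ j ∈ Icc (1 : Fin p → ℕ) (fun _ => m),
          gammaCoeff m j * (∏ r, (j r : ℝ) ^ (α r + 1)) *
          ∫ v in Set.Icc (-1 : Fin p → ℝ) 1,
        (1 - s) ^ (2 * m - 1) * (∏ r, v r ^ α r) * Φ α (fun r => s * (j r : ℝ) * v r / 2) := by
      intro s
      simp only [← integral_const_mul]
      rw [← integral_finsetSum _ fun j _ => (hKv α hα j s).const_mul _]
      congr 1
      ext v
      simp only [mul_sum]
      exact sum_congr rfl fun j _ => by ring
    simp only [e1]
    rw [intervalIntegral.integral_finsetSum fun j _ =>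
      ((hKs α hα j).const_mul _).intervalIntegrable _ _]
    simp only [intervalIntegral.integral_const_mul, hI]
  have hR : ∀ j : Fin p → ℕ, ∫ v in Set.Icc (-1 : Fin p → ℝ) 1, ((2 * m : ℕ) : ℝ) *
        ∫ s in (0 : ℝ)..1, (1 - s) ^ (2 * m - 1) * ∑ α ∈ multiIndices p (2 * m),
          (∏ q, ((j q : ℝ) / 2 * v q) ^ α q) / (∏ q, ((α q).factorial : ℝ)) *
            Φ α (fun r => s * (j r : ℝ) * v r / 2) =
      ∑ α ∈ multiIndices p (2 * m), ((2 * m : ℕ) : ℝ) * ((∏ q, ((j q : ℝ) / 2) ^ α q) /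
        (∏ q, ((α q).factorial : ℝ))) * I α j := by
    intro j
    have e1 : ∀ v : Fin p → ℝ, ∫ s in (0 : ℝ)..1, (1 - s) ^ (2 * m - 1) *
        ∑ α ∈ multiIndices p (2 * m),
          (∏ q, ((j q : ℝ) / 2 * v q) ^ α q) / (∏ q, ((α q).factorial : ℝ)) *
            Φ α (fun r => s * (j r : ℝ) * v r / 2) =
        ∑ α ∈ multiIndices p (2 * m), ((∏ q, ((j q : ℝ) / 2) ^ α q) /
          (∏ q, ((α q).factorial : ℝ))) * ∫ s in (0 : ℝ)..1,
            (1 - s) ^ (2 * m - 1) * (∏ r, v r ^ α r) * Φ α (fun r => s * (j r : ℝ) * v r / 2) := by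
      intro v
      simp only [← intervalIntegral.integral_const_mul]
      rw [← intervalIntegral.integral_finsetSum fun α hα =>
        (Continuous.intervalIntegrable (by have := hΦ α hα; fun_prop) _ _)]
      congr 1
      ext s
      rw [mul_sum]
      refine sum_congr rfl fun α _ => ?_
      simp only [mul_pow, prod_mul_distrib]
      ring
    simp only [e1]
    rw [integral_const_mul, integral_finsetSum _ fun α hα =>
      (((hKv' α hα j).const_mul _).continuousOn.integrableOn_compact isCompact_Icc), mul_sum]
    refine sum_congr rfl fun α hα => ?_
    rw [integral_const_mul, integral_cube_swap (hK α hα j), mul_assoc]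
  simp only [remainderOf, hR]
  rw [sum_congr rfl fun α hα => by rw [hL α hα]]
  simp only [mul_sum]
  rw [sum_comm (s := Icc (1 : Fin p → ℕ) (fun _ => m))]
  refine sum_congr rfl fun α hα => ?_
  refine sum_congr rfl fun j _ => ?_
  have e2 : (∏ r, ((j r : ℝ) / 2)) * ∏ q, ((j q : ℝ) / 2) ^ α q =
      (∏ r, (j r : ℝ) ^ (α r + 1)) / 2 ^ (2 * m + p) := by
    rw [← prod_mul_distrib]
    have : ∀ r, (j r : ℝ) / 2 * ((j r : ℝ) / 2) ^ α r = (j r : ℝ) ^ (α r + 1) / 2 ^ (α r + 1) := by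
      intro r; rw [← pow_succ', div_pow]
    simp only [this, prod_div_distrib]
    rw [prod_pow_eq_pow_sum, sum_add_distrib, mem_multiIndices.1 hα]
    simp
  have e3 : (2 : ℝ) ^ (2 * m + p) = 2 ^ (2 * m + p - 1) * 2 := by
    rw [← pow_succ]; congr 1; omega
  calc _ = ((m : ℝ) / 2 ^ (2 * m + p - 1)) * (∏ r, (j r : ℝ) ^ (α r + 1)) *
        (gammaCoeff m j * I α j / (∏ r, ((α r).factorial : ℝ))) := by ring
    _ = (2 * m) * ((∏ r, (j r : ℝ) ^ (α r + 1)) / 2 ^ (2 * m + p)) *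
        (gammaCoeff m j * I α j / (∏ r, ((α r).factorial : ℝ))) := by
      rw [e3]; field_simp
    _ = _ := by rw [← e2]; push_cast; ring

/-- The alternative summation formula at a point, with the remainder in integral form. -/
theorem apply_zero_eq {m : ℕ} (hm : 1 ≤ m) (hp : 1 ≤ p) {G g : (Fin p → ℝ) → ℝ}
    (hg : ContDiff ℝ ((2 * m : ℕ) : WithTop ℕ∞) g) {L : List (Fin p)} (hL : L.Nodup)
    (hall : ∀ r, r ∈ L) (h : IsIteratedDeriv L G g) :
    g 0 = ∑ j ∈ Icc (1 : Fin p → ℕ) (fun _ => m), gammaCoeff m j *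
        ∑ J : Finset (Fin p), (-1 : ℝ) ^ (p - J.card) *
          G (fun r => if r ∈ J then (j r : ℝ) / 2 else -((j r : ℝ) / 2)) -
      remainderOf m (fun α => multiDeriv α g) := by
  have hcont : ∀ α ∈ multiIndices p (2 * m), Continuous (multiDeriv α g) := fun α hα =>
    continuous_multiDeriv hg (mem_multiIndices.1 hα)
  have h1 : ∀ j : Fin p → ℕ, ∑ J : Finset (Fin p), (-1 : ℝ) ^ (p - J.card) *
      G (fun r => if r ∈ J then (j r : ℝ) / 2 else -((j r : ℝ) / 2)) =
      (∏ r, ((j r : ℝ) / 2)) * ∫ v in Set.Icc (-1 : Fin p → ℝ) 1,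
        g ((fun r => (j r : ℝ) / 2) * v) := by
    intro j
    have h2 := h.comp_mul (fun r => (j r : ℝ) / 2) 1
    have hgc := hg.continuous
    have h3 := integral_cube_eq_sum (by fun_prop) hL hall h2
    have hprod : (L.map fun r => (j r : ℝ) / 2).prod = ∏ r, ((j r : ℝ) / 2) := by
      rw [← List.prod_toFinset _ hL, show L.toFinset = univ by ext; simp [hall]]
    simp only [one_mul, hprod, integral_const_mul] at h3
    rw [h3]
    refine sum_congr rfl fun J _ => ?_
    congr 2
    ext r
    by_cases hr : r ∈ J <;> simp [hr]
  have h4 : ∀ (j : Fin p → ℕ) (v : Fin p → ℝ), g ((fun r => (j r : ℝ) / 2) * v) =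
      (∑ k ∈ range (2 * m), ∑ α ∈ multiIndices p k,
        (∏ q, ((j q : ℝ) / 2 * v q) ^ α q) / (∏ q, ((α q).factorial : ℝ)) * multiDeriv α g 0) +
      ((2 * m : ℕ) : ℝ) *
        ∫ s in (0 : ℝ)..1, (1 - s) ^ (2 * m - 1) * ∑ α ∈ multiIndices p (2 * m),
          (∏ q, ((j q : ℝ) / 2 * v q) ^ α q) / (∏ q, ((α q).factorial : ℝ)) *
            multiDeriv α g (fun r => s * (j r : ℝ) * v r / 2) := by
    intro j v
    have h5 := taylor_multiDeriv (by omega : 1 ≤ 2 * m) hg 0 ((fun r => (j r : ℝ) / 2) * v)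
    have e : ∀ s : ℝ, s • ((fun r => (j r : ℝ) / 2) * v) =
        fun r => s * (j r : ℝ) * v r / 2 := by
      intro s; ext r; simp; ring
    simp only [zero_add, e, Pi.mul_apply] at h5
    exact h5
  rw [remainderOf_eq hm hp hcont, eq_sub_iff_add_eq]
  have h0 := sum_gammaCoeff_taylor (p := p) hm (fun α => multiDeriv α g 0)
  rw [multiDeriv_zero] at h0
  rw [← h0, ← sum_add_distrib]
  refine sum_congr rfl fun j _ => ?_
  rw [← mul_add, ← mul_add, h1, ← integral_add]
  · simp only [h4]
  · exact (Continuous.continuousOn (by fun_prop)).integrableOn_compact isCompact_Icc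
  · refine (Continuous.continuousOn ?_).integrableOn_compact isCompact_Icc
    refine continuous_const.mul
      (intervalIntegral.continuous_parametric_intervalIntegral_of_continuous' ?_ _ _)
    simp only [Function.uncurry_def]
    refine Continuous.mul (by fun_prop) (continuous_finsetSum _ fun α hα => ?_)
    have := hcont α hα
    fun_prop

end Remainder

end AltSum

/-! ### Limit and size of the remainder. -/

namespace AltSum

open Finset MeasureTheory Filter Topology

section Limits

variable {p : ℕ}

instance minToInfty_isCountablyGenerated : (minToInfty p).IsCountablyGenerated := by
  unfold minToInfty; infer_instance

theorem eventually_minToInfty (hp : 1 ≤ p) (K : ℕ) :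
    ∀ᶠ n in minToInfty p, ∀ r, K ≤ n r := by
  have : Nonempty (Fin p) := ⟨⟨0, hp⟩⟩
  have h := (tendsto_comap (f := fun n : Fin p → ℕ => ⨅ r, n r) (x := atTop)).eventually
    (eventually_ge_atTop K)
  filter_upwards [h] with n hn r
  exact hn.trans (ciInf_le (OrderBot.bddBelow _) r)

theorem minToInfty_neBot (hp : 1 ≤ p) : (minToInfty p).NeBot := by
  have : Nonempty (Fin p) := ⟨⟨0, hp⟩⟩
  refine comap_neBot fun t ht => ?_
  obtain ⟨K, hK⟩ := mem_atTop_sets.1 ht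
  exact ⟨fun _ => K, hK _ (by simp)⟩

theorem exists_of_eventually_maxToInfty {P : (Fin p → ℝ) → Prop} (h : ∀ᶠ x in maxToInfty p, P x) :
    ∃ K : ℝ, ∀ x : Fin p → ℝ, (∃ r, K ≤ x r) → P x := by
  rw [maxToInfty, eventually_comap, eventually_atTop] at h
  obtain ⟨K, hK⟩ := h
  refine ⟨K, fun x ⟨r, hr⟩ => hK _ (hr.trans (le_ciSup (Set.finite_range x).bddAbove r)) x rfl⟩

theorem abs_scaled_le {m : ℕ} {j : Fin p → ℕ} (hj : j ∈ Finset.Icc (1 : Fin p → ℕ) (fun _ => m))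
    {s : ℝ} (hs : 0 ≤ s) {v : Fin p → ℝ} (hv : v ∈ Set.Icc (-1 : Fin p → ℝ) 1) (r : Fin p) :
    |s * (j r : ℝ) * v r / 2| ≤ s * (m / 2) := by
  have hjm : (j r : ℝ) ≤ m := by exact_mod_cast (Finset.mem_Icc.1 hj).2 r
  have hv1 : |v r| ≤ 1 := abs_le.2 ⟨hv.1 r, hv.2 r⟩
  rw [abs_div, abs_mul, abs_mul, abs_of_nonneg hs, Nat.abs_cast, abs_two]
  calc s * (j r : ℝ) * |v r| / 2 ≤ s * m * 1 / 2 := by gcongr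
    _ = _ := by ring

theorem abs_prod_pow_le_one {v : Fin p → ℝ} (hv : v ∈ Set.Icc (-1 : Fin p → ℝ) 1)
    (α : Fin p → ℕ) : |∏ r, v r ^ α r| ≤ 1 := by
  rw [abs_prod]
  refine prod_le_one (fun r _ => abs_nonneg _) fun r _ => ?_
  rw [abs_pow]
  exact pow_le_one₀ (abs_nonneg _) (abs_le.2 ⟨hv.1 r, hv.2 r⟩)

theorem abs_sum_gamma_le {m : ℕ} {Φ : (Fin p → ℝ) → ℝ} {C s : ℝ} {v : Fin p → ℝ}
    (α : Fin p → ℕ)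
    (h : ∀ j ∈ Finset.Icc (1 : Fin p → ℕ) (fun _ => m), |Φ (fun r => s * (j r : ℝ) * v r / 2)| ≤ C) :
    |∑ j ∈ Finset.Icc (1 : Fin p → ℕ) (fun _ => m),
      gammaCoeff m j * (∏ r, (j r : ℝ) ^ (α r + 1)) * Φ (fun r => s * (j r : ℝ) * v r / 2)| ≤
    (∑ j ∈ Finset.Icc (1 : Fin p → ℕ) (fun _ => m),
      |gammaCoeff m j| * ∏ r, (j r : ℝ) ^ (α r + 1)) * C := by
  refine (abs_sum_le_sum_abs _ _).trans ?_
  rw [sum_mul]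
  refine sum_le_sum fun j hj => ?_
  have h0 : (0 : ℝ) ≤ ∏ r, (j r : ℝ) ^ (α r + 1) := prod_nonneg fun r _ => by positivity
  rw [abs_mul, abs_mul, abs_of_nonneg h0]
  have := h j hj
  gcongr

/-- One member within `1` of the limit is bounded on the compact set, and eventually all members
stay within `2` of it. This gives the constant dominating function. -/
theorem eventually_bounded_of_tendstoUniformlyOn {ι : Type*} {l : Filter ι} [l.NeBot]
    {ψ : ι → (Fin p → ℝ) → ℝ} {S : (Fin p → ℝ) → ℝ} {K : Set (Fin p → ℝ)} (hK : IsCompact K)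
    (hψ : ∀ n, Continuous (ψ n)) (h : TendstoUniformlyOn ψ S l K) :
    ∃ C, ∀ᶠ n in l, ∀ u ∈ K, |ψ n u| ≤ C := by
  have h1 := Metric.tendstoUniformlyOn_iff.1 h 1 one_pos
  obtain ⟨n₀, hn₀⟩ := h1.exists
  obtain ⟨C, hC⟩ := hK.exists_bound_of_continuousOn (hψ n₀).continuousOn
  refine ⟨C + 2, ?_⟩
  filter_upwards [h1] with n hn u hu
  have e1 := hn u hu
  have e2 := hn₀ u hu
  have e3 := hC u hu
  rw [Real.dist_eq] at e1 e2
  rw [Real.norm_eq_abs] at e3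
  rw [abs_lt] at e1 e2
  rw [abs_le] at e3 ⊢
  constructor <;> linarith [e1.1, e1.2, e2.1, e2.2, e3.1, e3.2]

theorem tendsto_remainderOf {ι : Type*} {l : Filter ι} [l.NeBot] [l.IsCountablyGenerated]
    {m : ℕ} {Ψ : ι → (Fin p → ℕ) → (Fin p → ℝ) → ℝ} {S : (Fin p → ℕ) → (Fin p → ℝ) → ℝ}
    (hΨ : ∀ α ∈ multiIndices p (2 * m), ∀ n, Continuous (Ψ n α))
    (h : ∀ α ∈ multiIndices p (2 * m), TendstoUniformlyOn (fun n => Ψ n α) (S α) l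
      (Set.Icc (fun _ => -((m : ℝ) / 2)) (fun _ => (m : ℝ) / 2))) :
    Tendsto (fun n => remainderOf m (Ψ n)) l (𝓝 (remainderOf m S)) := by
  unfold remainderOf
  refine Tendsto.const_mul _ (tendsto_finsetSum _ fun α hα => Tendsto.const_mul _ ?_)
  obtain ⟨C, hC⟩ := eventually_bounded_of_tendstoUniformlyOn isCompact_Icc (hΨ α hα) (h α hα)
  set D := (∑ j ∈ Finset.Icc (1 : Fin p → ℕ) (fun _ => m),
    |gammaCoeff m j| * ∏ r, (j r : ℝ) ^ (α r + 1)) * C with hD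
  have hmem : ∀ s ∈ Set.uIoc (0 : ℝ) 1, ∀ v ∈ Set.Icc (-1 : Fin p → ℝ) 1,
      ∀ j ∈ Finset.Icc (1 : Fin p → ℕ) (fun _ => m), (fun r => s * (j r : ℝ) * v r / 2) ∈
        Set.Icc (fun _ : Fin p => -((m : ℝ) / 2)) (fun _ => (m : ℝ) / 2) := by
    intro s hs v hv j hj
    rw [Set.uIoc_of_le zero_le_one] at hs
    have key : ∀ r, |s * (j r : ℝ) * v r / 2| ≤ (m : ℝ) / 2 := fun r =>
      (abs_scaled_le hj hs.1.le hv r).trans (mul_le_of_le_one_left (by positivity) hs.2)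
    exact ⟨fun r => (abs_le.1 (key r)).1, fun r => (abs_le.1 (key r)).2⟩
  have hcont : ∀ n, Continuous (Function.uncurry fun (s : ℝ) (v : Fin p → ℝ) =>
      (∏ r, v r ^ α r) * ∑ j ∈ Finset.Icc (1 : Fin p → ℕ) (fun _ => m),
        gammaCoeff m j * (∏ r, (j r : ℝ) ^ (α r + 1)) *
          Ψ n α (fun r => s * (j r : ℝ) * v r / 2)) := by
    intro n
    have := hΨ α hα n
    simp only [Function.uncurry_def]
    fun_prop
  have hbound : ∀ᶠ n in l, ∀ s ∈ Set.uIoc (0 : ℝ) 1, ∀ v ∈ Set.Icc (-1 : Fin p → ℝ) 1,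
      ‖(∏ r, v r ^ α r) * ∑ j ∈ Finset.Icc (1 : Fin p → ℕ) (fun _ => m),
        gammaCoeff m j * (∏ r, (j r : ℝ) ^ (α r + 1)) *
          Ψ n α (fun r => s * (j r : ℝ) * v r / 2)‖ ≤ D := by
    filter_upwards [hC] with n hn s hs v hv
    rw [Real.norm_eq_abs, abs_mul]
    have h1 := abs_sum_gamma_le (Φ := Ψ n α) α (fun j hj => hn _ (hmem s hs v hv j hj))
    calc _ ≤ 1 * D := by
          gcongr
          exact abs_prod_pow_le_one hv α
      _ = D := one_mul _
  refine intervalIntegral.tendsto_integral_filter_of_dominated_convergence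
    (fun _ => D * volume.real (Set.Icc (-1 : Fin p → ℝ) 1)) ?_ ?_ (by simp) ?_
  · refine Eventually.of_forall fun n => Continuous.aestronglyMeasurable ?_
    exact (by fun_prop : Continuous fun s : ℝ => (1 - s) ^ (2 * m - 1)).mul
      (continuous_parametric_integral_of_continuous (hcont n) isCompact_Icc)
  · filter_upwards [hbound] with n hn
    refine Eventually.of_forall fun s hs => ?_
    have h1 := norm_setIntegral_le_of_norm_le_const (μ := volume)
      (isCompact_Icc (a := (-1 : Fin p → ℝ)) (b := 1)).measure_lt_top (hn s hs)
    rw [norm_mul]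
    rw [Set.uIoc_of_le zero_le_one] at hs
    have h2 : ‖(1 - s) ^ (2 * m - 1)‖ ≤ 1 := by
      rw [norm_pow, Real.norm_eq_abs, abs_of_nonneg (by linarith [hs.2])]
      exact pow_le_one₀ (by linarith [hs.2]) (by linarith [hs.1])
    calc _ ≤ 1 * (D * volume.real (Set.Icc (-1 : Fin p → ℝ) 1)) := by gcongr
      _ = _ := one_mul _
  · refine Eventually.of_forall fun s hs => Tendsto.const_mul _ ?_
    refine tendsto_integral_filter_of_dominated_convergence (fun _ => D) ?_ ?_ ?_ ?_
    · refine Eventually.of_forall fun n => Continuous.aestronglyMeasurable ?_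
      exact (hcont n).comp (by fun_prop : Continuous fun v : Fin p → ℝ => (s, v))
    · filter_upwards [hbound] with n hn
      exact (ae_restrict_iff' measurableSet_Icc).2 (Eventually.of_forall fun v hv => hn s hs v hv)
    · exact integrableOn_const (isCompact_Icc.measure_lt_top).ne
    · refine (ae_restrict_iff' measurableSet_Icc).2 (Eventually.of_forall fun v hv => ?_)
      refine Tendsto.const_mul _ (tendsto_finsetSum _ fun j hj => Tendsto.const_mul _ ?_)
      exact (h α hα).tendsto_at (hmem s hs v hv j hj)

theorem integral_cube_prod_abs_pow (α : Fin p → ℕ) :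
    ∫ v in Set.Icc (-1 : Fin p → ℝ) 1, ∏ r, |v r| ^ α r = ∏ r, 2 / ((α r : ℝ) + 1) := by
  rw [volume_restrict_Icc_eq_pi, integral_fintype_prod_eq_prod (fun r (t : ℝ) => |t| ^ α r)]
  refine prod_congr rfl fun r _ => ?_
  rw [integral_Icc_eq_integral_Ioc, ← intervalIntegral.integral_of_le (by norm_num),
    ← intervalIntegral.integral_add_adjacent_intervals (b := 0)
      (Continuous.intervalIntegrable (by fun_prop) _ _)
      (Continuous.intervalIntegrable (by fun_prop) _ _)]
  have h1 : ∫ t in (0 : ℝ)..1, |t| ^ α r = 1 / ((α r : ℝ) + 1) := by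
    rw [intervalIntegral.integral_congr (g := fun t => t ^ α r), integral_pow]
    · simp
    · intro t ht
      rw [Set.uIcc_of_le zero_le_one] at ht
      simp only [abs_of_nonneg ht.1]
  have h2 : ∫ t in (-1 : ℝ)..0, |t| ^ α r = 1 / ((α r : ℝ) + 1) := by
    rw [← h1]
    have := intervalIntegral.integral_comp_neg (a := 0) (b := 1) (fun t : ℝ => |t| ^ α r)
    simp only [abs_neg, neg_zero] at this
    exact this.symm
  rw [h1, h2]; ring

theorem abs_remainderOf_le {m : ℕ} (hm : 1 ≤ m) (hp : 1 ≤ p) {M : ℝ}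
    {Φ : (Fin p → ℕ) → (Fin p → ℝ) → ℝ}
    (h : ∀ α ∈ multiIndices p (2 * m), ∀ u : Fin p → ℝ, (∀ r, |u r| < (m : ℝ) / 2) →
      |Φ α u| ≤ M) :
    |remainderOf m Φ| ≤ remainderBound p m M := by
  have hm0 : (0 : ℝ) < m := by exact_mod_cast hm
  have hα : ∀ α ∈ multiIndices p (2 * m), |∫ s in (0 : ℝ)..1, (1 - s) ^ (2 * m - 1) *
        ∫ v in Set.Icc (-1 : Fin p → ℝ) 1, (∏ r, v r ^ α r) *
          ∑ j ∈ Finset.Icc (1 : Fin p → ℕ) (fun _ => m),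
            gammaCoeff m j * (∏ r, (j r : ℝ) ^ (α r + 1)) *
              Φ α (fun r => s * (j r : ℝ) * v r / 2)| ≤
      1 / (2 * m) * ((∏ r, 2 / ((α r : ℝ) + 1)) * ((∑ j ∈ Finset.Icc (1 : Fin p → ℕ) (fun _ => m),
        |gammaCoeff m j| * ∏ r, (j r : ℝ) ^ (α r + 1)) * M)) := by
    intro α hα
    set D := (∑ j ∈ Finset.Icc (1 : Fin p → ℕ) (fun _ => m),
      |gammaCoeff m j| * ∏ r, (j r : ℝ) ^ (α r + 1)) * M with hD
    have hs1 : ∫ s in (0 : ℝ)..1, (1 - s) ^ (2 * m - 1) = 1 / (2 * m) := by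
      have := intervalIntegral.integral_comp_sub_left (a := 0) (b := 1)
        (fun s : ℝ => s ^ (2 * m - 1)) 1
      rw [this, sub_self, sub_zero, integral_pow, one_pow, zero_pow (by omega), sub_zero]
      congr 1
      have : ((2 * m - 1 : ℕ) : ℝ) = 2 * m - 1 := by
        rw [Nat.cast_sub (by omega)]; push_cast; ring
      rw [this]; ring
    rw [← hs1, ← intervalIntegral.integral_mul_const, ← Real.norm_eq_abs]
    refine intervalIntegral.norm_integral_le_of_norm_le
      (g := fun s => (1 - s) ^ (2 * m - 1) * ((∏ r, 2 / ((α r : ℝ) + 1)) * D)) zero_le_one ?_ ?_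
    swap
    · exact Continuous.intervalIntegrable (by fun_prop) _ _
    -- Dropping the null set `s = 1` keeps the argument of `Φ` strictly inside the cube, where `h`
    -- applies.
    filter_upwards [volume.ae_ne (1 : ℝ)] with s hs1 hs
    have hslt : s < 1 := lt_of_le_of_ne hs.2 hs1
    rw [norm_mul, norm_pow, Real.norm_eq_abs (1 - s), abs_of_nonneg (by linarith)]
    refine mul_le_mul_of_nonneg_left ?_ (pow_nonneg (by linarith) _)
    rw [← integral_cube_prod_abs_pow, ← integral_mul_const]
    refine norm_integral_le_of_norm_le ?_ ?_
    · exact (Continuous.continuousOn (by fun_prop)).integrableOn_compact isCompact_Icc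
    · refine (ae_restrict_iff' measurableSet_Icc).2 (Eventually.of_forall fun v hv => ?_)
      rw [norm_mul, Real.norm_eq_abs, Real.norm_eq_abs, abs_prod]
      simp only [abs_pow]
      refine mul_le_mul_of_nonneg_left ?_ (prod_nonneg fun r _ => by positivity)
      refine abs_sum_gamma_le α fun j hj => h α hα _ fun r => ?_
      refine (abs_scaled_le hj hs.1.le hv r).trans_lt ?_
      exact mul_lt_of_lt_one_left (by positivity) hslt
  unfold remainderOf remainderBound
  rw [abs_mul, abs_of_nonneg (by positivity)]
  have e3 : (2 : ℝ) ^ (2 * m + p - 1) * 2 = 2 ^ (2 * m) * 2 ^ p := by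
    rw [← pow_succ, ← pow_add]; congr 1; omega
  calc _ ≤ (m : ℝ) / 2 ^ (2 * m + p - 1) * ∑ α ∈ multiIndices p (2 * m),
      1 / (∏ r, ((α r).factorial : ℝ)) * (1 / (2 * m) * ((∏ r, 2 / ((α r : ℝ) + 1)) *
        ((∑ j ∈ Finset.Icc (1 : Fin p → ℕ) (fun _ => m),
          |gammaCoeff m j| * ∏ r, (j r : ℝ) ^ (α r + 1)) * M))) := by
        gcongr
        refine (abs_sum_le_sum_abs _ _).trans (sum_le_sum fun α h' => ?_)
        rw [abs_mul, abs_of_nonneg (by positivity)]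
        have := hα α h'
        gcongr
    _ = _ := by
        rw [mul_sum, mul_sum]
        refine sum_congr rfl fun α _ => ?_
        have e1 : (∏ r, ((α r + 1).factorial : ℝ)) =
            (∏ r, ((α r : ℝ) + 1)) * ∏ r, ((α r).factorial : ℝ) := by
          rw [← prod_mul_distrib]
          exact prod_congr rfl fun r _ => by rw [Nat.factorial_succ]; push_cast; ring
        have e2 : ∏ r, 2 / ((α r : ℝ) + 1) = 2 ^ p / ∏ r, ((α r : ℝ) + 1) := by
          rw [prod_div_distrib]; simp
        have h4 : (0 : ℝ) < ∏ r, ((α r).factorial : ℝ) := prod_pos fun r _ => by positivity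
        have h5 : (0 : ℝ) < ∏ r, ((α r : ℝ) + 1) := prod_pos fun r _ => by positivity
        rw [e1, e2]
        generalize ∑ j ∈ Finset.Icc (1 : Fin p → ℕ) (fun _ => m),
          |gammaCoeff m j| * ∏ r, (j r : ℝ) ^ (α r + 1) = B
        have e4 : (m : ℝ) / 2 ^ (2 * m + p - 1) = 2 * m / (2 ^ (2 * m) * 2 ^ p) := by
          rw [← e3]; field_simp
        rw [e4]
        field_simp

end Limits

end AltSum

/-! ### Boundary terms: passing from order `m` to order `m₀`. -/

namespace AltSum

open Finset MeasureTheory Filter Topology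

section Boundary

variable {p : ℕ}

theorem sum_sigma_monomial_eq {l l' k : ℕ} (h : k < 2 * l) (h' : k < 2 * l') {α : Fin p → ℕ}
    (hα : α ∈ multiIndices p k) :
    ∑ q ∈ Fintype.piFinset (fun _ : Fin p => (Finset.Icc 1 l).sigma range),
      (∏ r, gamma1 l (q r).1) * ∏ r, (-(1 / 2) + ((q r).1 : ℝ) / 2 - (q r).2) ^ α r =
    ∑ q ∈ Fintype.piFinset (fun _ : Fin p => (Finset.Icc 1 l').sigma range),
      (∏ r, gamma1 l' (q r).1) * ∏ r, (-(1 / 2) + ((q r).1 : ℝ) / 2 - (q r).2) ^ α r := by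
  have key : ∀ l : ℕ, ∑ q ∈ Fintype.piFinset (fun _ : Fin p => (Finset.Icc 1 l).sigma range),
      (∏ r, gamma1 l (q r).1) * ∏ r, (-(1 / 2) + ((q r).1 : ℝ) / 2 - (q r).2) ^ α r =
      ∏ r, ∑ j ∈ Finset.Icc 1 l, gamma1 l j *
        ∑ i ∈ range j, (-(1 / 2) + (j : ℝ) / 2 - i) ^ α r := by
    intro l
    simp only [← prod_mul_distrib]
    rw [← prod_univ_sum (t := fun _ : Fin p => (Finset.Icc 1 l).sigma range)
      (f := fun r (q : Σ _ : ℕ, ℕ) => gamma1 l q.1 * (-(1 / 2) + (q.1 : ℝ) / 2 - q.2) ^ α r)]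
    refine prod_congr rfl fun r _ => ?_
    rw [sum_sigma]
    simp only [mul_sum]
  rw [key, key]
  refine prod_congr rfl fun r _ => ?_
  have hr : α r ≤ k := by
    rw [← mem_multiIndices.1 hα]; exact single_le_sum (fun _ _ => Nat.zero_le _) (mem_univ r)
  exact sum_gamma1_moment_eq (by omega) (by omega)

/-- The remainder of the Taylor expansion of order `N`. -/
noncomputable def taylorRemainder (N : ℕ) (F : (Fin p → ℝ) → ℝ) (x w : Fin p → ℝ) : ℝ :=
  N * ∫ s in (0 : ℝ)..1, (1 - s) ^ (N - 1) * ∑ α ∈ multiIndices p N,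
    (∏ q, w q ^ α q) / (∏ q, ((α q).factorial : ℝ)) * multiDeriv α F (x + s • w)

/-- The shifts of the arguments of `F` in the functional `A`. -/
noncomputable def shiftOf (q : Fin p → Σ _ : ℕ, ℕ) : Fin p → ℝ :=
  fun r => -(1 / 2) + ((q r).1 : ℝ) / 2 - (q r).2

/-- The center of the arguments of `F` in the functional `A`. -/
noncomputable def centerOf (J : Finset (Fin p)) (n : Fin p → ℕ) : Fin p → ℝ :=
  fun r => restrictTo J n r - 1 / 2

/-- Expanding `F` to order `2l₀` about the common centre `n 1_J - 1/2`, the Taylor polynomials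
contribute equally for both orders because the moments agree. -/
theorem AJ_sub_AJ_eq {l l₀ : ℕ} (hl₀ : 1 ≤ l₀) (hl : l₀ ≤ l) {F : (Fin p → ℝ) → ℝ}
    (hF : ContDiff ℝ ((2 * l₀ : ℕ) : WithTop ℕ∞) F) (J : Finset (Fin p)) (n : Fin p → ℕ) :
    AJ l F J n - AJ l₀ F J n =
      ∑ q ∈ Fintype.piFinset (fun _ : Fin p => (Finset.Icc 1 l).sigma range),
        (∏ r, gamma1 l (q r).1) * taylorRemainder (2 * l₀) F (centerOf J n) (shiftOf q) -
      ∑ q ∈ Fintype.piFinset (fun _ : Fin p => (Finset.Icc 1 l₀).sigma range),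
        (∏ r, gamma1 l₀ (q r).1) *
          taylorRemainder (2 * l₀) F (centerOf J n) (shiftOf q) := by
  set P : (Fin p → Σ _ : ℕ, ℕ) → ℝ := fun q => ∑ k ∈ range (2 * l₀), ∑ α ∈ multiIndices p k,
        (∏ r, shiftOf q r ^ α r) / (∏ r, ((α r).factorial : ℝ)) *
          multiDeriv α F (centerOf J n) with hP
  have h1 : ∀ l : ℕ, AJ l F J n =
      ∑ q ∈ Fintype.piFinset (fun _ : Fin p => (Finset.Icc 1 l).sigma range),
        (∏ r, gamma1 l (q r).1) * P q +
      ∑ q ∈ Fintype.piFinset (fun _ : Fin p => (Finset.Icc 1 l).sigma range),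
        (∏ r, gamma1 l (q r).1) * taylorRemainder (2 * l₀) F (centerOf J n) (shiftOf q) := by
    intro l
    rw [AJ_eq_sum_sigma, ← sum_add_distrib]
    refine sum_congr rfl fun q _ => ?_
    rw [← mul_add]
    congr 1
    have h2 := taylor_multiDeriv (by omega : 1 ≤ 2 * l₀) hF (centerOf J n) (shiftOf q)
    have e : (fun r => restrictTo J n r - 1 + ((q r).1 : ℝ) / 2 - ((q r).2 : ℝ)) =
        centerOf J n + shiftOf q := by
      ext r; simp only [centerOf, shiftOf, Pi.add_apply]; ring
    rw [e]
    exact h2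
  have h3 : ∀ l : ℕ, ∑ q ∈ Fintype.piFinset (fun _ : Fin p => (Finset.Icc 1 l).sigma range),
        (∏ r, gamma1 l (q r).1) * P q = ∑ k ∈ range (2 * l₀), ∑ α ∈ multiIndices p k,
        multiDeriv α F (centerOf J n) / (∏ r, ((α r).factorial : ℝ)) *
        ∑ q ∈ Fintype.piFinset (fun _ : Fin p => (Finset.Icc 1 l).sigma range),
          (∏ r, gamma1 l (q r).1) * ∏ r, shiftOf q r ^ α r := by
    intro l
    simp only [hP, mul_sum]
    rw [sum_comm]
    refine sum_congr rfl fun k _ => ?_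
    rw [sum_comm]
    exact sum_congr rfl fun α _ => sum_congr rfl fun q _ => by ring
  have h4 : ∑ q ∈ Fintype.piFinset (fun _ : Fin p => (Finset.Icc 1 l).sigma range),
        (∏ r, gamma1 l (q r).1) * P q =
      ∑ q ∈ Fintype.piFinset (fun _ : Fin p => (Finset.Icc 1 l₀).sigma range),
        (∏ r, gamma1 l₀ (q r).1) * P q := by
    rw [h3, h3]
    refine sum_congr rfl fun k hk => sum_congr rfl fun α hα => ?_
    congr 1
    have := mem_range.1 hk
    exact sum_sigma_monomial_eq (by omega) (by omega) hα
  rw [h1 l, h1 l₀, h4]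
  ring

theorem eventually_abs_multiDeriv_le (hp : 1 ≤ p) {g : (Fin p → ℝ) → ℝ}
    (hg : Tendsto g (maxToInfty p) (𝓝 0)) {J : Finset (Fin p)} (hJ : J.Nonempty)
    (w : Fin p → ℝ) {δ : ℝ} (hδ : 0 < δ) :
    ∀ᶠ n in minToInfty p, ∀ s ∈ Set.Icc (0 : ℝ) 1, |g (centerOf J n + s • w)| < δ := by
  have h1 : ∀ᶠ x in maxToInfty p, |g x| < δ := by
    have := Metric.tendsto_nhds.1 hg δ hδ
    simpa [Real.dist_eq] using this
  obtain ⟨K, hK⟩ := exists_of_eventually_maxToInfty h1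
  obtain ⟨r, hr⟩ := hJ
  -- For `r ∈ J` this puts the coordinate `n_r - 1/2 + s w_r` above `K` for all `s ∈ [0,1]`; one
  -- large coordinate is enough.
  filter_upwards [eventually_minToInfty hp ⌈K + 1 / 2 + |w r|⌉₊] with n hn s hs
  refine hK _ ⟨r, ?_⟩
  have h2 : K + 1 / 2 + |w r| ≤ n r := (Nat.le_ceil _).trans (by exact_mod_cast hn r)
  have h3 : -|w r| ≤ s * w r := by
    have h4 : |s * w r| ≤ |w r| := by
      rw [abs_mul, abs_of_nonneg hs.1]
      exact mul_le_of_le_one_left (abs_nonneg _) hs.2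
    exact (neg_le_neg h4).trans (neg_abs_le _)
  simp only [centerOf, restrictTo, Pi.add_apply, Pi.smul_apply, smul_eq_mul, if_pos hr]
  linarith

theorem tendsto_taylorRemainder (hp : 1 ≤ p) {N : ℕ} {F : (Fin p → ℝ) → ℝ}
    (hF : ContDiff ℝ (N : WithTop ℕ∞) F)
    (hF0 : ∀ α : Fin p → ℕ, ∑ r, α r = N → Tendsto (multiDeriv α F) (maxToInfty p) (𝓝 0))
    {J : Finset (Fin p)} (hJ : J.Nonempty) (w : Fin p → ℝ) :
    Tendsto (fun n => taylorRemainder N F (centerOf J n) w) (minToInfty p) (𝓝 0) := by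
  have hev : ∀ δ : ℝ, 0 < δ → ∀ᶠ n in minToInfty p, ∀ α ∈ multiIndices p N,
      ∀ s ∈ Set.Icc (0 : ℝ) 1, |multiDeriv α F (centerOf J n + s • w)| < δ := fun δ hδ =>
    (eventually_all_finset _).2 fun α hα =>
      eventually_abs_multiDeriv_le hp (hF0 α (mem_multiIndices.1 hα)) hJ w hδ
  suffices h : Tendsto (fun n => ∫ s in (0 : ℝ)..1, (1 - s) ^ (N - 1) *
      ∑ α ∈ multiIndices p N, (∏ q, w q ^ α q) / (∏ q, ((α q).factorial : ℝ)) *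
        multiDeriv α F (centerOf J n + s • w)) (minToInfty p) (𝓝 (∫ _ in (0 : ℝ)..1, (0 : ℝ))) by
    have h2 := h.const_mul (N : ℝ)
    rwa [intervalIntegral.integral_zero, mul_zero] at h2
  refine intervalIntegral.tendsto_integral_filter_of_dominated_convergence
    (fun _ => ∑ α ∈ multiIndices p N, |(∏ q, w q ^ α q) / (∏ q, ((α q).factorial : ℝ))|)
    ?_ ?_ (by simp) ?_
  · refine Eventually.of_forall fun n => Continuous.aestronglyMeasurable ?_
    refine Continuous.mul (by fun_prop) (continuous_finsetSum _ fun α hα => ?_)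
    have := continuous_multiDeriv hF (mem_multiIndices.1 hα)
    fun_prop
  · filter_upwards [hev 1 one_pos] with n hn
    refine Eventually.of_forall fun s hs => ?_
    rw [Set.uIoc_of_le zero_le_one] at hs
    rw [norm_mul, norm_pow, Real.norm_eq_abs (1 - s), abs_of_nonneg (by linarith [hs.2])]
    have h1 : (1 - s) ^ (N - 1) ≤ 1 := pow_le_one₀ (by linarith [hs.2]) (by linarith [hs.1])
    refine (mul_le_of_le_one_left (norm_nonneg _) h1).trans ?_
    refine (norm_sum_le _ _).trans (sum_le_sum fun α hα => ?_)
    rw [norm_mul, Real.norm_eq_abs, Real.norm_eq_abs]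
    exact mul_le_of_le_one_right (abs_nonneg _) (hn α hα s ⟨hs.1.le, hs.2⟩).le
  · refine Eventually.of_forall fun s hs => ?_
    rw [Set.uIoc_of_le zero_le_one] at hs
    rw [← mul_zero ((1 - s) ^ (N - 1))]
    refine Tendsto.const_mul _ ?_
    have hz' : ∑ α ∈ multiIndices p N,
        (∏ q, w q ^ α q) / (∏ q, ((α q).factorial : ℝ)) * 0 = 0 := by simp
    rw [← hz']
    refine tendsto_finsetSum _ fun α hα => Tendsto.const_mul _ ?_
    refine Metric.tendsto_nhds.2 fun ε hε => ?_
    filter_upwards [hev ε hε] with n hn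
    simpa [Real.dist_eq] using hn α hα s ⟨hs.1.le, hs.2⟩

theorem tendsto_AJ_sub_AJ (hp : 1 ≤ p) {l l₀ : ℕ} (hl₀ : 1 ≤ l₀) (hl : l₀ ≤ l)
    {F : (Fin p → ℝ) → ℝ} (hF : ContDiff ℝ ((2 * l₀ : ℕ) : WithTop ℕ∞) F)
    (hF0 : ∀ α : Fin p → ℕ, ∑ r, α r = 2 * l₀ →
      Tendsto (multiDeriv α F) (maxToInfty p) (𝓝 0))
    {J : Finset (Fin p)} (hJ : J.Nonempty) :
    Tendsto (fun n => AJ l F J n - AJ l₀ F J n) (minToInfty p) (𝓝 0) := by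
  simp only [AJ_sub_AJ_eq hl₀ hl hF]
  have h : ∀ l : ℕ, Tendsto (fun n =>
      ∑ q ∈ Fintype.piFinset (fun _ : Fin p => (Finset.Icc 1 l).sigma range),
        (∏ r, gamma1 l (q r).1) * taylorRemainder (2 * l₀) F (centerOf J n) (shiftOf q))
      (minToInfty p) (𝓝 0) := by
    intro l
    have := tendsto_finsetSum (Fintype.piFinset (fun _ : Fin p => (Finset.Icc 1 l).sigma range))
      fun q _ => (tendsto_taylorRemainder hp hF hF0 hJ (shiftOf q)).const_mul
        (∏ r, gamma1 l (q r).1)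
    simpa using this
  simpa using (h l).sub (h l₀)

theorem tendsto_tildeA_sub_tildeA (hp : 1 ≤ p) {l l₀ : ℕ} (hl₀ : 1 ≤ l₀) (hl : l₀ ≤ l)
    {F : (Fin p → ℝ) → ℝ} (hF : ContDiff ℝ ((2 * l₀ : ℕ) : WithTop ℕ∞) F)
    (hF0 : ∀ α : Fin p → ℕ, ∑ r, α r = 2 * l₀ →
      Tendsto (multiDeriv α F) (maxToInfty p) (𝓝 0)) :
    Tendsto (fun n => tildeA l F n - tildeA l₀ F n) (minToInfty p) (𝓝 0) := by
  unfold tildeA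
  simp only [← sum_sub_distrib, ← mul_sub]
  have := tendsto_finsetSum ((univ : Finset (Finset (Fin p))).erase ∅)
    fun J hJ => (tendsto_AJ_sub_AJ hp hl₀ hl hF hF0
      (nonempty_iff_ne_empty.2 (ne_of_mem_erase hJ))).const_mul ((-1 : ℝ) ^ (p - J.card))
  simpa using this

theorem sum_box_eq (hp : 1 ≤ p) {m : ℕ} (hm : 1 ≤ m) {F f : (Fin p → ℝ) → ℝ}
    (hf : ContDiff ℝ ((2 * m : ℕ) : WithTop ℕ∞) f) (hFf : IsAntiderivative F f)
    (n : Fin p → ℕ) :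
    ∑ k ∈ box n, f (fun r => (k r : ℝ)) = tildeA m F n + (-1) ^ p * AJ m F ∅ 0 -
      remainderOf m (fun α => shiftedSum (multiDeriv α f) n) := by
  obtain ⟨L, hL, hall, hder⟩ := hFf.exists_list
  have h1 := apply_zero_eq hm hp (contDiff_shiftedSum hf n) hL hall (hder.shiftedSum n)
  have e0 : shiftedSum f n 0 = ∑ k ∈ box n, f (fun r => (k r : ℝ)) := by simp [shiftedSum]
  have e1 : remainderOf m (fun α => multiDeriv α (shiftedSum f n)) =
      remainderOf m (fun α => shiftedSum (multiDeriv α f) n) := by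
    unfold remainderOf
    congr 1
    refine sum_congr rfl fun α hα => ?_
    simp only [multiDeriv_shiftedSum hf (mem_multiIndices.1 hα)]
  have e2 : ∑ j ∈ Finset.Icc (1 : Fin p → ℕ) (fun _ => m), gammaCoeff m j *
        ∑ J : Finset (Fin p), (-1 : ℝ) ^ (p - J.card) *
          shiftedSum F n (fun r => if r ∈ J then (j r : ℝ) / 2 else -((j r : ℝ) / 2)) =
      ∑ J : Finset (Fin p), (-1 : ℝ) ^ (p - J.card) * AJ m F J n := by
    simp only [shiftedSum]
    simp only [sum_sign_sum_box_eq]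
    simp only [AJ, mul_sum]
    rw [sum_comm]
    exact sum_congr rfl fun J _ => sum_congr rfl fun j _ => sum_congr rfl fun i _ => by ring
  rw [← e0, h1, e1, e2, tildeA, ← sum_erase_add univ _ (mem_univ (∅ : Finset (Fin p))),
    AJ_empty m F n]
  simp

end Boundary

end AltSum

/-! ### Assembly of the theorem. -/

theorem theorem3p1 (p m₀ m : ℕ) (hp : 1 ≤ p) (hm₀ : 1 ≤ m₀) (hm : m₀ ≤ m)
    (f F : (Fin p → ℝ) → ℝ)
    (hf : ContDiff ℝ ((2 * m : ℕ) : WithTop ℕ∞) f)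
    (hF : ContDiff ℝ ((2 * m₀ : ℕ) : WithTop ℕ∞) F)
    (hFf : AltSum.IsAntiderivative F f)
    (hF0 : ∀ α : Fin p → ℕ, ∑ r, α r = 2 * m₀ →
      Filter.Tendsto (AltSum.multiDeriv α F) (AltSum.maxToInfty p) (nhds 0))
    (hunif : ∀ α : Fin p → ℕ, ∑ r, α r = 2 * m →
      ∃ S : (Fin p → ℝ) → ℝ,
        TendstoUniformlyOn (fun n u => AltSum.shiftedSum (AltSum.multiDeriv α f) n u) S
          (AltSum.minToInfty p) (Set.Icc (fun _ => -((m : ℝ) / 2)) (fun _ => (m : ℝ) / 2))) :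
    -- the limit exists and has the stated value
    (Filter.Tendsto
        (fun n => (∑ k ∈ AltSum.box n, f (fun r => (k r : ℝ))) - AltSum.tildeA m₀ F n)
        (AltSum.minToInfty p)
        (nhds ((-1) ^ p * AltSum.AJ m F ∅ 0 - AltSum.remainderInfty m f)) ∧
      AltSum.altSum m₀ F f = (-1) ^ p * AltSum.AJ m F ∅ 0 - AltSum.remainderInfty m f) ∧
    -- the alternative expressions of `A^J_{l,F}(n)`
    (∀ l : ℕ, 1 ≤ l → ∀ (J : Finset (Fin p)) (n : Fin p → ℕ),
      AltSum.AJ l F J n =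
          ∑ β ∈ Finset.Icc (fun _ : Fin p => 1 - (l : ℤ)) (fun _ => (l : ℤ) - 1),
            AltSum.tauCoeff l (fun r => 1 + (β r).natAbs) *
              F (fun r => AltSum.restrictTo J n r - 1 / 2 - (β r : ℝ) / 2) ∧
      AltSum.AJ l F J n =
          ∑ α ∈ Finset.Icc (0 : Fin p → ℕ) (fun _ => l - 1),
            AltSum.tauCoeff l (fun r => 1 + α r) *
              ∑ β ∈ AltSum.absFiber α,
                F (fun r => AltSum.restrictTo J n r - 1 / 2 - (β r : ℝ) / 2)) ∧
    -- the bounds on the remainder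
    (∀ M : ℝ,
      (∀ (n : Fin p → ℕ) (α : Fin p → ℕ), ∑ r, α r = 2 * m →
        ∀ u : Fin p → ℝ, (∀ r, u r ∈ Set.Ioc (-((m : ℝ) / 2)) ((m : ℝ) / 2)) →
          |AltSum.shiftedSum (AltSum.multiDeriv α f) n u| ≤ M) →
      |AltSum.remainderInfty m f| ≤ AltSum.remainderBound p m M ∧
      AltSum.remainderBound p m M ≤ AltSum.simpleBound 1.0331 p m M ∧
      (2 ≤ m → AltSum.remainderBound p m M ≤ AltSum.simpleBound 1.001 p m M)) ∧
    -- the values at `J = ∅` or `n = 0`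
    (∀ l : ℕ, 1 ≤ l → ∀ (J : Finset (Fin p)) (n : Fin p → ℕ),
      AltSum.AJ l F ∅ 0 = AltSum.AJ l F ∅ n ∧
      AltSum.AJ l F ∅ 0 = AltSum.AJ l F J 0 ∧
      AltSum.AJ l F ∅ 0 =
        ∑ α ∈ Finset.Icc (0 : Fin p → ℕ) (fun _ => l - 1),
          AltSum.tauCoeff l (fun r => 1 + α r) *
            ∑ β ∈ AltSum.absFiber α, F (fun r => (β r : ℝ) / 2 - 1 / 2)) := by
  have hm1 : 1 ≤ m := hm₀.trans hm
  have hne : (AltSum.minToInfty p).NeBot := AltSum.minToInfty_neBot hp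
  have hseries : ∀ α : Fin p → ℕ, ∑ r, α r = 2 * m →
      TendstoUniformlyOn (fun n u => AltSum.shiftedSum (AltSum.multiDeriv α f) n u)
        (AltSum.shiftedSeries (AltSum.multiDeriv α f)) (AltSum.minToInfty p)
        (Set.Icc (fun _ => -((m : ℝ) / 2)) (fun _ => (m : ℝ) / 2)) := by
    intro α hα
    obtain ⟨S, hS⟩ := hunif α hα
    -- On the cube the uniform limit must coincide with the `limUnder` defining `shiftedSeries`.
    exact hS.congr_right fun u hu => (hS.tendsto_at hu).limUnder_eq.symm
  have hlim : Filter.Tendsto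
      (fun n => (∑ k ∈ AltSum.box n, f (fun r => (k r : ℝ))) - AltSum.tildeA m₀ F n)
      (AltSum.minToInfty p)
      (nhds ((-1) ^ p * AltSum.AJ m F ∅ 0 - AltSum.remainderInfty m f)) := by
    have h1 := AltSum.tendsto_tildeA_sub_tildeA hp hm₀ hm hF hF0
    have h2 := AltSum.tendsto_remainderOf (l := AltSum.minToInfty p) (m := m)
      (Ψ := fun n α => AltSum.shiftedSum (AltSum.multiDeriv α f) n)
      (S := fun α => AltSum.shiftedSeries (AltSum.multiDeriv α f))
      (fun α hα n => AltSum.continuous_shiftedSum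
        (AltSum.continuous_multiDeriv hf (AltSum.mem_multiIndices.1 hα)) n)
      (fun α hα => hseries α (AltSum.mem_multiIndices.1 hα))
    have h3 := (h1.add_const ((-1) ^ p * AltSum.AJ m F ∅ 0)).sub h2
    rw [zero_add, ← AltSum.remainderInfty_eq] at h3
    refine h3.congr fun n => ?_
    rw [AltSum.sum_box_eq hp hm1 hf hFf]
    ring
  refine ⟨⟨hlim, hlim.limUnder_eq⟩, fun l hl J n => ⟨AltSum.AJ_eq_sum_tau l F J n,
    AltSum.AJ_eq_sum_absFiber hl F J n⟩, fun M hM => ?_,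
    fun l hl J n => ⟨AltSum.AJ_empty l F n, AltSum.AJ_zero l F J, AltSum.AJ_empty_eq_sum hl F⟩⟩
  have hm0 : (0 : ℝ) < m := by exact_mod_cast hm1
  have hM0 : 0 ≤ M := by
    -- Nonnegativity of `M` follows from any instance of its hypothesis, here with `α = 2m e_0`.
    refine (abs_nonneg _).trans (hM 0 (Pi.single ⟨0, hp⟩ (2 * m)) (by simp) 0 fun r => ?_)
    rw [Pi.zero_apply, Set.mem_Ioc]
    constructor <;> linarith
  refine ⟨?_, AltSum.remainderBound_le hp hm1 hM0,
    fun hm2 => AltSum.remainderBound_le_of_two_le hp hm2 hM0⟩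
  rw [AltSum.remainderInfty_eq]
  refine AltSum.abs_remainderOf_le hm1 hp fun α hα u hu => ?_
  have hα' := AltSum.mem_multiIndices.1 hα
  have hu' : ∀ r, -((m : ℝ) / 2) < u r ∧ u r < (m : ℝ) / 2 := fun r => abs_lt.1 (hu r)
  have ht := (hseries α hα').tendsto_at (x := u) ⟨fun r => (hu' r).1.le, fun r => (hu' r).2.le⟩
  -- The open cube lies both in the half-open cube where the partial sums are bounded and in the
  -- closed one where they converge, so the bound passes to the series.
  exact le_of_tendsto ht.abs (Filter.Eventually.of_forall fun n =>
    hM n α hα' u fun r => ⟨(hu' r).1, (hu' r).2.le⟩)
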